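/- Let $\mathcal X,\mathcal Y,\mathcal Z$ be finite nonempty sets and let $W(z|x,y)$ be a two-user discrete memoryless multiple access channel (MAC) with input alphabets $\mathcal X$ (user 1), $\mathcal Y$ (user 2) and output alphabet $\mathcal Z$; $W^n$ denotes its $n$-fold product. The MAC is *1-spoofable* if there are conditional distributions $Q(y|\tilde x,\tilde y)$ and $Q'(x|\tilde x,x')$ such that for all $x',\tilde x\in\mathcal X$, $\tilde y\in\mathcal Y$, $z\in\mathcal Z$ $$\sum_{y}Q(y|\tilde x,\tilde y)W(z|x',y)=\sum_{y}Q(y|x',\tilde y)W(z|\tilde x,y)=\sum_{x}Q'(x|\tilde x,x')W(z|x,\tilde y),$$ and *2-spoofable* if there are conditional distributions $Q(x|\tilde x,\tilde y)$ and $Q'(y|\tilde y,y')$ such that for all $\tilde x\in\mathcal X$, $\tilde y,y'\in\mathcal Y$, $z\in\mathcal Z$ $$\sum_{x}Q(x|\tilde x,\tilde y)W(z|x,y')=\sum_{x}Q(x|\tilde x,y')W(z|x,\tilde y)=\sum_{y}Q'(y|\tilde y,y')W(z|\tilde x,y).$$ An $(N_1,N_2,n)$ *adversary identifying code* (with $N_1,N_2\ge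 1$ and $\mathcal M_i=\{1,\dots,N_i\}$) consists of encoders $f_1:\mathcal M_1\to\mathcal X^n$, $f_2:\mathcal M_2\to\mathcal Y^n$ and a decoder $\phi:\mathcal Z^n\to(\mathcal M_1\times\mathcal M_2)\cup\{\mathbf 1,\mathbf 2\}$, where the output $\mathbf i$ accuses user $i$; all three maps are deterministic. Its *probability of error* is $P_e=\max\{P_{e,0},P_{e,1},P_{e,2}\}$, where $$P_{e,0}=\frac1{N_1N_2}\sum_{m_1,m_2}W^n\big(\{\mathbf z:\phi(\mathbf z)\ne(m_1,m_2)\}\,\big|\,f_1(m_1),f_2(m_2)\big),$$ $$P_{e,1}=\max_{\mathbf x\in\mathcal X^n}\frac1{N_2}\sum_{m_2}W^n\big(\{\mathbf z:\phi(\mathbf z)\notin(\mathcal M_1\times\{m_2\})\cup\{\mathbf 1\}\}\,\big|\,\mathbf x,f_2(m_2)\big),$$ $$P_{e,2}=\max_{\mathbf y\in\mathcal Y^n}\frac1{N_1}\sum_{m_1}W^n\big(\{\mathbf z:\phi(\mathbf z)\notin(\{m_1\}\times\mathcal M_2)\cup\{\mathbf 2\}\}\,\big|\,f_1(m_1),\mathbf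 y\big).$$ A pair $(R_1,R_2)$ of nonnegative reals is *achievable* if there is a sequence of $(\lfloor 2^{nR_1}\rfloor,\lfloor 2^{nR_2}\rfloor,n)$ adversary identifying codes whose probability of error tends to $0$ as $n\to\infty$. The *capacity region* $\mathcal C\subseteq\mathbb R^2$ is the closure of the set of achievable pairs, and $C_i=\sup\{R_i:(R_1,R_2)\in\mathcal C\}$ for $i=1,2$. **Theorem.** 1. If the MAC is 1-spoofable, then every $(N_1,N_2,n)$ adversary identifying code with $N_1\ge 2$ has probability of error at least $1/12$; thus user 1 cannot communicate with adversary identification: $C_1=0$. 2. If the MAC is 2-spoofable, then every $(N_1,N_2,n)$ adversary identifying code with $N_2\ge 2$ has probability of error at least $1/12$; thus user 2 cannot communicate with adversary identification: $C_2=0$. 3. If the MAC is neither 1-spoofable nor 2-spoofable, then $\mathcal C$ has nonempty interior; that is, both users can communicate reliably with adversary identification at positive rates: some pair $(R_1,R_2)$ with $R_1>0$ and $R_2>0$ is achievable. -/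

import Mathlib

open Filter Topology

/-- A two-user discrete memoryless multiple access channel (MAC): `prob x y` is the distribution
of the output when user 1 sends `x` and user 2 sends `y`. -/
structure MAC (X Y Z : Type*) [Fintype Z] where
  /-- The transition probability `W(z | x, y)`. -/
  prob : X → Y → Z → ℝ
  /-- Every `W(· | x, y)` is a probability distribution on `Z`. -/
  prob_mem : ∀ x y, prob x y ∈ stdSimplex ℝ Z

/-- What the decoder may output: a pair of messages, or an accusation of one of the users. -/
inductive DecoderOutput (M₁ M₂ : Type*) where
  | messages (m₁ : M₁) (m₂ : M₂)
  | blameOne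
  | blameTwo

/-- An `(N₁, N₂, n)` deterministic adversary identifying code. -/
structure AdvIdCode (X Y Z : Type*) (N₁ N₂ n : ℕ) where
  enc₁ : Fin N₁ → (Fin n → X)
  enc₂ : Fin N₂ → (Fin n → Y)
  dec : (Fin n → Z) → DecoderOutput (Fin N₁) (Fin N₂)

noncomputable section

namespace MAC

variable {X Y Z : Type*} [Fintype X] [Fintype Y] [Fintype Z]

/-- The `n`-fold product channel: the probability of the event `E` in `Z^n` when the users send the
sequences `x` and `y`. -/
def probPow (W : MAC X Y Z) {n : ℕ} (x : Fin n → X) (y : Fin n → Y) (E : Set (Fin n → Z)) : ℝ :=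
  ∑ z : Fin n → Z, E.indicator (fun z => ∏ t, W.prob (x t) (y t) (z t)) z

/-- A MAC is 1-spoofable if there are conditional distributions `Q(y | x̃, ỹ)` and `Q'(x | x̃, x')`
for which the three output distributions below coincide. -/
def IsOneSpoofable (W : MAC X Y Z) : Prop :=
  ∃ (Q : X → Y → Y → ℝ) (Q' : X → X → X → ℝ),
    (∀ xt yt, Q xt yt ∈ stdSimplex ℝ Y) ∧ (∀ xt x', Q' xt x' ∈ stdSimplex ℝ X) ∧
    ∀ (x' xt : X) (yt : Y) (z : Z),
      ∑ y, Q xt yt y * W.prob x' y z = ∑ y, Q x' yt y * W.prob xt y z ∧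
      ∑ y, Q x' yt y * W.prob xt y z = ∑ x, Q' xt x' x * W.prob x yt z

/-- A MAC is 2-spoofable if there are conditional distributions `Q(x | x̃, ỹ)` and `Q'(y | ỹ, y')`
for which the three output distributions below coincide. -/
def IsTwoSpoofable (W : MAC X Y Z) : Prop :=
  ∃ (Q : X → Y → X → ℝ) (Q' : Y → Y → Y → ℝ),
    (∀ xt yt, Q xt yt ∈ stdSimplex ℝ X) ∧ (∀ yt y', Q' yt y' ∈ stdSimplex ℝ Y) ∧
    ∀ (xt : X) (yt y' : Y) (z : Z),
      ∑ x, Q xt yt x * W.prob x y' z = ∑ x, Q xt y' x * W.prob x yt z ∧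
      ∑ x, Q xt y' x * W.prob x yt z = ∑ y, Q' yt y' y * W.prob xt y z

end MAC

namespace AdvIdCode

variable {X Y Z : Type*} [Fintype X] [Fintype Y] [Fintype Z] {N₁ N₂ n : ℕ}

/-- The error event when both users are honest and send `m₁` and `m₂`: the decoder does not
output `(m₁, m₂)`. -/
def errorEvent (c : AdvIdCode X Y Z N₁ N₂ n) (m₁ : Fin N₁) (m₂ : Fin N₂) : Set (Fin n → Z) :=
  {z | c.dec z ≠ .messages m₁ m₂}

/-- The error event when user 1 is adversarial and user 2 sends `m₂`: the decoder neither
accuses user 1 nor outputs a pair whose second message is `m₂`. -/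
def errorEvent₂ (c : AdvIdCode X Y Z N₁ N₂ n) (m₂ : Fin N₂) : Set (Fin n → Z) :=
  {z | c.dec z ≠ .blameOne ∧ ∀ m₁, c.dec z ≠ .messages m₁ m₂}

/-- The error event when user 2 is adversarial and user 1 sends `m₁`: the decoder neither
accuses user 2 nor outputs a pair whose first message is `m₁`. -/
def errorEvent₁ (c : AdvIdCode X Y Z N₁ N₂ n) (m₁ : Fin N₁) : Set (Fin n → Z) :=
  {z | c.dec z ≠ .blameTwo ∧ ∀ m₂, c.dec z ≠ .messages m₁ m₂}

/-- Average probability of error when both users are honest. -/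
def errorHonest (c : AdvIdCode X Y Z N₁ N₂ n) (W : MAC X Y Z) : ℝ :=
  (1 / ((N₁ : ℝ) * (N₂ : ℝ))) *
    ∑ m₁, ∑ m₂, W.probPow (c.enc₁ m₁) (c.enc₂ m₂) (c.errorEvent m₁ m₂)

/-- Average probability of error when user 1 is adversarial: a maximum over the finitely many
sequences that user 1 may send. -/
def errorAdvOne (c : AdvIdCode X Y Z N₁ N₂ n) (W : MAC X Y Z) : ℝ :=
  ⨆ x : Fin n → X, (1 / (N₂ : ℝ)) * ∑ m₂, W.probPow x (c.enc₂ m₂) (c.errorEvent₂ m₂)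

/-- Average probability of error when user 2 is adversarial: a maximum over the finitely many
sequences that user 2 may send. -/
def errorAdvTwo (c : AdvIdCode X Y Z N₁ N₂ n) (W : MAC X Y Z) : ℝ :=
  ⨆ y : Fin n → Y, (1 / (N₁ : ℝ)) * ∑ m₁, W.probPow (c.enc₁ m₁) y (c.errorEvent₁ m₁)

/-- The average probability of error of the code over the MAC `W`. -/
def errorProb (c : AdvIdCode X Y Z N₁ N₂ n) (W : MAC X Y Z) : ℝ :=
  max (c.errorHonest W) (max (c.errorAdvOne W) (c.errorAdvTwo W))

end AdvIdCode

namespace MAC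

variable {X Y Z : Type*} [Fintype X] [Fintype Y] [Fintype Z]

/-- `R = (R₁, R₂)` is an achievable rate pair for communication with adversary identification. -/
def IsAchievable (W : MAC X Y Z) (R : ℝ × ℝ) : Prop :=
  0 ≤ R.1 ∧ 0 ≤ R.2 ∧
    ∃ c : ∀ n : ℕ,
        AdvIdCode X Y Z ⌊(2 : ℝ) ^ ((n : ℝ) * R.1)⌋₊ ⌊(2 : ℝ) ^ ((n : ℝ) * R.2)⌋₊ n,
      Tendsto (fun n => (c n).errorProb W) atTop (𝓝 0)

/-- The capacity region of communication with adversary identification. -/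
def capacityRegion (W : MAC X Y Z) : Set (ℝ × ℝ) :=
  closure {R | W.IsAchievable R}

end MAC

end

/-! Converse. For messages `m ≠ m'` of user 1 and `k` of user 2, the spoofing kernels give one
output law with three explanations: user 1 honestly sends `m'` while user 2 attacks, user 1 honestly
sends `m` while user 2 attacks, or user 2 honestly sends `k` while user 1 attacks. Every decoder
output is an error in at least one of these situations, so the three error probabilities add up to
at least one. Averaging over `m ≠ m'` and `k` gives error at least `1/5`, which is stronger than
`1/12` (`AdvIdCode.one_div_five_le_errorProb`).

Achievability. A message is a candidate if, for some input of the other user, its codeword looks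
uniform and independent of that input and of the other codewords, with the output behaving as the
channel prescribes. Two candidates of user 1 together with a candidate of user 2 would give three
approximate formulas for one joint type. Exact equality of the formulas yields spoofing kernels, so
by compactness a non-spoofable channel keeps them a fixed distance apart (`exists_not_consistent`).
Hence if both users have candidates, both candidates are unique, and a user without candidates can
be accused.

It remains to find codebooks for which an honest message is a candidate whatever the other user
sends. A single codeword fails against a fixed attack with exponentially small probability, which
need not beat the number of attack sequences. That a large constant number `k` of codewords fail
together has probability equal to the `k`-th power, and this does beat it (`card_le_card_bad_le`).
So against every attack only boundedly many messages are bad, a vanishing fraction at positive rate.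
All statements about user 2 follow by exchanging the users. -/

/-- The probability of `E` under the product of the weights `p t`. -/
noncomputable def prodProb {Z : Type*} [Fintype Z] {n : ℕ} (p : Fin n → Z → ℝ)
    (E : Set (Fin n → Z)) : ℝ :=
  ∑ z : Fin n → Z, E.indicator (fun z => ∏ t, p t (z t)) z

/-! ### Product distributions and concentration. -/

section ProdProb

variable {Y Z : Type*} [Fintype Y] [Fintype Z] {n : ℕ} {p : Fin n → Z → ℝ}

theorem sum_pi_prod (g : Fin n → Z → ℝ) :
    ∑ z : Fin n → Z, ∏ t, g t (z t) = ∏ t, ∑ a, g t a := by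
  classical
  rw [Finset.prod_univ_sum, Fintype.piFinset_univ]

theorem prodProb_univ (hp : ∀ t, p t ∈ stdSimplex ℝ Z) : prodProb p Set.univ = 1 := by
  simp only [prodProb, Set.indicator_univ]
  rw [sum_pi_prod]
  exact Finset.prod_eq_one fun t _ => (hp t).2

theorem prodProb_mono (hp : ∀ t, p t ∈ stdSimplex ℝ Z) {E F : Set (Fin n → Z)} (h : E ⊆ F) :
    prodProb p E ≤ prodProb p F :=
  Finset.sum_le_sum fun z _ => Set.indicator_le_indicator_of_subset h
    (fun _ => Finset.prod_nonneg fun t _ => (hp t).1 _) z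

theorem prodProb_nonneg (hp : ∀ t, p t ∈ stdSimplex ℝ Z) (E : Set (Fin n → Z)) :
    0 ≤ prodProb p E :=
  Finset.sum_nonneg fun z _ => Set.indicator_nonneg
    (fun _ _ => Finset.prod_nonneg fun t _ => (hp t).1 _) z

theorem prodProb_le_one (hp : ∀ t, p t ∈ stdSimplex ℝ Z) (E : Set (Fin n → Z)) :
    prodProb p E ≤ 1 :=
  (prodProb_mono hp (Set.subset_univ E)).trans (prodProb_univ hp).le

theorem prodProb_union_le (hp : ∀ t, p t ∈ stdSimplex ℝ Z) (E F : Set (Fin n → Z)) :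
    prodProb p (E ∪ F) ≤ prodProb p E + prodProb p F := by
  classical
  simp only [prodProb]
  rw [← Finset.sum_add_distrib]
  refine Finset.sum_le_sum fun z _ => ?_
  have h0 : 0 ≤ ∏ t, p t (z t) := Finset.prod_nonneg fun t _ => (hp t).1 _
  simp only [Set.indicator_apply, Set.mem_union]
  by_cases h1 : z ∈ E <;> by_cases h2 : z ∈ F <;> simp [h1, h2, h0]

theorem prodProb_iUnion_le {ι : Type*} [Fintype ι] (hp : ∀ t, p t ∈ stdSimplex ℝ Z)
    (E : ι → Set (Fin n → Z)) : prodProb p (⋃ i, E i) ≤ ∑ i, prodProb p (E i) := by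
  classical
  simp only [prodProb]
  rw [Finset.sum_comm]
  refine Finset.sum_le_sum fun z _ => ?_
  have h0 : ∀ i, 0 ≤ (E i).indicator (fun z => ∏ t, p t (z t)) z := fun i =>
    Set.indicator_nonneg (fun _ _ => Finset.prod_nonneg fun t _ => (hp t).1 _) z
  by_cases h : z ∈ ⋃ i, E i
  · obtain ⟨i, hi⟩ := Set.mem_iUnion.1 h
    rw [Set.indicator_of_mem h, ← Set.indicator_of_mem hi (fun z => ∏ t, p t (z t))]
    exact Finset.single_le_sum (fun i _ => h0 i) (Finset.mem_univ i)
  · rw [Set.indicator_of_notMem h]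
    exact Finset.sum_nonneg fun i _ => h0 i

theorem prodProb_iUnion_le_card_mul {ι : Type*} [Fintype ι] (hp : ∀ t, p t ∈ stdSimplex ℝ Z)
    (E : ι → Set (Fin n → Z)) {b : ℝ} (h : ∀ i, prodProb p (E i) ≤ b) :
    prodProb p (⋃ i, E i) ≤ Fintype.card ι * b := by
  refine (prodProb_iUnion_le hp E).trans ((Finset.sum_le_sum fun i _ => h i).trans ?_)
  simp

/-- Averaging a product distribution over a random input drawn from a product distribution
gives the product of the averages. -/
theorem sum_prod_mul_prodProb (q : Fin n → Y → ℝ) (w : Fin n → Y → Z → ℝ)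
    (E : Set (Fin n → Z)) :
    ∑ y : Fin n → Y, (∏ t, q t (y t)) * prodProb (fun t => w t (y t)) E =
      prodProb (fun t z => ∑ y, q t y * w t y z) E := by
  classical
  simp only [prodProb, Finset.mul_sum]
  rw [Finset.sum_comm]
  refine Finset.sum_congr rfl fun z _ => ?_
  by_cases hz : z ∈ E
  · simp only [Set.indicator_of_mem hz]
    rw [← sum_pi_prod (fun t y => q t y * w t y (z t))]
    simp only [Finset.prod_mul_distrib]
  · simp [Set.indicator_of_notMem hz]

/-- The estimate `exp u ≤ 1 + u + u ^ 2` for `|u| ≤ 1` is averaged; the linear term vanishes because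
`g` is centred. -/
theorem sum_mul_exp_le {p g : Z → ℝ} (hp : p ∈ stdSimplex ℝ Z) (hg : ∀ z, |g z| ≤ 1)
    (h0 : ∑ z, p z * g z = 0) {s : ℝ} (hs0 : 0 ≤ s) (hs : s ≤ 1) :
    ∑ z, p z * Real.exp (s * g z) ≤ Real.exp (s ^ 2) := by
  have h : ∀ z, p z * Real.exp (s * g z) ≤ p z * (1 + s ^ 2) + s * (p z * g z) := by
    intro z
    have hb : |s * g z| ≤ 1 := by
      rw [abs_mul, abs_of_nonneg hs0]
      exact mul_le_one₀ hs (abs_nonneg _) (hg z)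
    have h1 := (abs_le.1 (Real.abs_exp_sub_one_sub_id_le hb)).2
    have h2 : (s * g z) ^ 2 ≤ s ^ 2 := by
      rw [mul_pow]
      exact mul_le_of_le_one_right (sq_nonneg s) ((sq_le_one_iff_abs_le_one _).2 (hg z))
    have h3 : Real.exp (s * g z) ≤ 1 + s ^ 2 + s * g z := by linarith
    calc p z * Real.exp (s * g z) ≤ p z * (1 + s ^ 2 + s * g z) :=
          mul_le_mul_of_nonneg_left h3 (hp.1 z)
      _ = _ := by ring
  calc ∑ z, p z * Real.exp (s * g z) ≤ ∑ z, (p z * (1 + s ^ 2) + s * (p z * g z)) :=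
        Finset.sum_le_sum fun z _ => h z
    _ = s ^ 2 + 1 := by
        rw [Finset.sum_add_distrib, ← Finset.sum_mul, ← Finset.mul_sum, h0, hp.2]; ring
    _ ≤ Real.exp (s ^ 2) := Real.add_one_le_exp _

theorem prodProb_sum_gt_le (hp : ∀ t, p t ∈ stdSimplex ℝ Z) {g : Fin n → Z → ℝ}
    (hg : ∀ t z, |g t z| ≤ 1) (h0 : ∀ t, ∑ z, p t z * g t z = 0) {δ : ℝ} (hδ0 : 0 ≤ δ)
    (hδ : δ ≤ 2) :
    prodProb p {z | δ * n < ∑ t, g t (z t)} ≤ Real.exp (-(n * δ ^ 2 / 4)) := by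
  classical
  -- This choice minimises the Chernoff exponent `s ^ 2 - s * δ`, with value `-δ ^ 2 / 4`; the
  -- assumption `δ ≤ 2` ensures `s ≤ 1`.
  set s := δ / 2 with hs
  have key : ∀ z : Fin n → Z, {z : Fin n → Z | δ * n < ∑ t, g t (z t)}.indicator
      (fun z => ∏ t, p t (z t)) z ≤
      Real.exp (-(s * (δ * n))) * ∏ t, (p t (z t) * Real.exp (s * g t (z t))) := by
    intro z
    have hpz : 0 ≤ ∏ t, p t (z t) := Finset.prod_nonneg fun t _ => (hp t).1 _
    rw [Finset.prod_mul_distrib, ← Real.exp_sum, ← Finset.mul_sum, mul_left_comm, ← Real.exp_add]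
    simp only [Set.indicator_apply, Set.mem_ofPred_eq]
    split_ifs with hz
    · refine le_mul_of_one_le_right hpz (Real.one_le_exp ?_)
      nlinarith
    · positivity
  refine (Finset.sum_le_sum fun z _ => key z).trans ?_
  rw [← Finset.mul_sum, sum_pi_prod (fun t z => p t z * Real.exp (s * g t z))]
  have h1 : ∏ t, ∑ z, p t z * Real.exp (s * g t z) ≤ ∏ _t : Fin n, Real.exp (s ^ 2) :=
    Finset.prod_le_prod
      (fun t _ => Finset.sum_nonneg fun z _ => mul_nonneg ((hp t).1 z) (Real.exp_pos _).le)
      (fun t _ => sum_mul_exp_le (hp t) (hg t) (h0 t) (by positivity) (by linarith))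
  refine (mul_le_mul_of_nonneg_left h1 (Real.exp_pos _).le).trans ?_
  rw [Finset.prod_const, Finset.card_univ, Fintype.card_fin, ← Real.exp_nat_mul, ← Real.exp_add]
  refine Real.exp_le_exp.2 (le_of_eq ?_)
  rw [hs]; ring

/-- A Chernoff bound for sums of independent centred variables bounded by one. -/
theorem prodProb_abs_sum_gt_le (hp : ∀ t, p t ∈ stdSimplex ℝ Z) {g : Fin n → Z → ℝ}
    (hg : ∀ t z, |g t z| ≤ 1) (h0 : ∀ t, ∑ z, p t z * g t z = 0) {δ : ℝ} (hδ0 : 0 ≤ δ)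
    (hδ : δ ≤ 2) :
    prodProb p {z | δ * n < |∑ t, g t (z t)|} ≤ 2 * Real.exp (-(n * δ ^ 2 / 4)) := by
  have h1 := prodProb_sum_gt_le hp hg h0 hδ0 hδ
  have h2 := prodProb_sum_gt_le (g := fun t z => - g t z) hp (by simpa using hg)
    (by simpa using h0) hδ0 hδ
  refine (prodProb_mono hp ?_).trans ((prodProb_union_le hp _ _).trans
    ((add_le_add h1 h2).trans (two_mul _).ge))
  intro z hz
  simp only [Set.mem_union, Set.mem_ofPred_eq, Finset.sum_neg_distrib] at hz ⊢
  exact lt_abs.1 hz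

end ProdProb

/-! ### Symmetry between the users. -/

namespace MAC

variable {X Y Z : Type*} [Fintype Z]

/-- The channel in which the users exchange their roles. -/
def swap (W : MAC X Y Z) : MAC Y X Z where
  prob y x := W.prob x y
  prob_mem y x := W.prob_mem x y

theorem sum_sum_mul_prob (W : MAC X Y Z) {D : Type*} [Fintype D] (p : D → ℝ) (f : D → X)
    (g : D → Y) : ∑ e, ∑ d, p d * W.prob (f d) (g d) e = ∑ d, p d := by
  rw [Finset.sum_comm]
  simp only [← Finset.mul_sum, (W.prob_mem _ _).2, mul_one]

theorem prob_le_one (W : MAC X Y Z) (a : X) (b : Y) (e : Z) : W.prob a b e ≤ 1 := by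
  rw [← (W.prob_mem a b).2]
  exact Finset.single_le_sum (fun i _ => (W.prob_mem a b).1 i) (Finset.mem_univ e)

theorem probPow_eq_prodProb (W : MAC X Y Z) {n : ℕ} (x : Fin n → X) (y : Fin n → Y)
    (E : Set (Fin n → Z)) : W.probPow x y E = prodProb (fun t => W.prob (x t) (y t)) E := rfl

theorem isOneSpoofable_swap [Fintype X] [Fintype Y] {W : MAC X Y Z} (h : W.IsTwoSpoofable) :
    W.swap.IsOneSpoofable := by
  obtain ⟨Q, Q', hQ, hQ', h⟩ := h
  exact ⟨fun yt xt => Q xt yt, Q', fun _ _ => hQ _ _, hQ', fun y' yt xt z => h xt yt y' z⟩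

theorem isTwoSpoofable_of_swap [Fintype X] [Fintype Y] {W : MAC X Y Z}
    (h : W.swap.IsOneSpoofable) : W.IsTwoSpoofable := by
  obtain ⟨Q, Q', hQ, hQ', h⟩ := h
  exact ⟨fun xt yt => Q yt xt, Q', fun _ _ => hQ _ _, hQ', fun xt yt y' z => h y' yt xt z⟩

end MAC

/-- Exchange the roles of the users in the decoder's output. -/
def DecoderOutput.swap {M₁ M₂ : Type*} : DecoderOutput M₁ M₂ → DecoderOutput M₂ M₁
  | .messages m₁ m₂ => .messages m₂ m₁
  | .blameOne => .blameTwo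
  | .blameTwo => .blameOne

namespace AdvIdCode

variable {X Y Z : Type*} {N₁ N₂ n : ℕ}

/-- The code in which the users exchange their roles. -/
def swap (c : AdvIdCode X Y Z N₁ N₂ n) : AdvIdCode Y X Z N₂ N₁ n where
  enc₁ := c.enc₂
  enc₂ := c.enc₁
  dec z := (c.dec z).swap

theorem errorEvent₁_swap (c : AdvIdCode X Y Z N₁ N₂ n) (m : Fin N₂) :
    c.swap.errorEvent₁ m = c.errorEvent₂ m := by
  ext z
  simp only [errorEvent₁, errorEvent₂, swap, Set.mem_ofPred_eq]
  cases c.dec z <;> simp [DecoderOutput.swap]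

theorem errorEvent₂_swap (c : AdvIdCode X Y Z N₁ N₂ n) (m : Fin N₁) :
    c.swap.errorEvent₂ m = c.errorEvent₁ m := by
  ext z
  simp only [errorEvent₁, errorEvent₂, swap, Set.mem_ofPred_eq]
  cases c.dec z <;> simp [DecoderOutput.swap]

theorem errorEvent_swap (c : AdvIdCode X Y Z N₁ N₂ n) (m₁ : Fin N₁) (m₂ : Fin N₂) :
    c.swap.errorEvent m₂ m₁ = c.errorEvent m₁ m₂ := by
  ext z
  simp only [errorEvent, swap, Set.mem_ofPred_eq]
  cases c.dec z <;> simp [DecoderOutput.swap, and_comm]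

variable [Fintype Z]

theorem probPow_swap (W : MAC X Y Z) (x : Fin n → X) (y : Fin n → Y)
    (E : Set (Fin n → Z)) : W.swap.probPow y x E = W.probPow x y E := rfl

theorem errorProb_swap (c : AdvIdCode X Y Z N₁ N₂ n) (W : MAC X Y Z) :
    c.swap.errorProb W.swap = c.errorProb W := by
  have h0 : c.swap.errorHonest W.swap = c.errorHonest W := by
    simp only [errorHonest, errorEvent_swap, probPow_swap]
    rw [Finset.sum_comm, mul_comm (N₁ : ℝ)]
    rfl
  have h1 : c.swap.errorAdvOne W.swap = c.errorAdvTwo W := by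
    simp only [errorAdvOne, errorAdvTwo, errorEvent₂_swap, probPow_swap]
    rfl
  have h2 : c.swap.errorAdvTwo W.swap = c.errorAdvOne W := by
    simp only [errorAdvOne, errorAdvTwo, errorEvent₁_swap, probPow_swap]
    rfl
  rw [errorProb, errorProb, h0, h1, h2, max_comm (c.errorAdvTwo W)]

/-! ### Converse: spoofable channels. -/

theorem sum_le_errorAdvOne [Finite X] (c : AdvIdCode X Y Z N₁ N₂ n) (W : MAC X Y Z) (hN : 1 ≤ N₂)
    (x : Fin n → X) :
    ∑ m₂, W.probPow x (c.enc₂ m₂) (c.errorEvent₂ m₂) ≤ N₂ * c.errorAdvOne W := by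
  have hN' : (0 : ℝ) < N₂ := by exact_mod_cast hN
  have h := le_ciSup (f := fun x : Fin n → X =>
    (1 / (N₂ : ℝ)) * ∑ m₂, W.probPow x (c.enc₂ m₂) (c.errorEvent₂ m₂)) (Set.finite_range _).bddAbove x
  have h' : (1 / (N₂ : ℝ)) * ∑ m₂, W.probPow x (c.enc₂ m₂) (c.errorEvent₂ m₂) ≤
    c.errorAdvOne W := h
  rw [one_div, inv_mul_le_iff₀ hN'] at h'
  exact h'

theorem sum_le_errorAdvTwo [Finite Y] (c : AdvIdCode X Y Z N₁ N₂ n) (W : MAC X Y Z) (hN : 1 ≤ N₁)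
    (y : Fin n → Y) :
    ∑ m₁, W.probPow (c.enc₁ m₁) y (c.errorEvent₁ m₁) ≤ N₁ * c.errorAdvTwo W := by
  have h := c.swap.sum_le_errorAdvOne W.swap hN y
  simp only [errorEvent₂_swap] at h
  have h2 : c.swap.errorAdvOne W.swap = c.errorAdvTwo W := by
    simp only [errorAdvOne, errorAdvTwo, errorEvent₂_swap, probPow_swap]
    rfl
  rwa [h2] at h

theorem sum_prod_mul_le [Fintype Y] {q : Fin n → Y → ℝ} (hq : ∀ t, q t ∈ stdSimplex ℝ Y)
    (a : (Fin n → Y) → ℝ) {b : ℝ} (h : ∀ y, a y ≤ b) :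
    ∑ y : Fin n → Y, (∏ t, q t (y t)) * a y ≤ b := by
  calc ∑ y : Fin n → Y, (∏ t, q t (y t)) * a y ≤ ∑ y : Fin n → Y, (∏ t, q t (y t)) * b :=
        Finset.sum_le_sum fun y _ =>
          mul_le_mul_of_nonneg_left (h y) (Finset.prod_nonneg fun t _ => (hq t).1 _)
    _ = b := by
        rw [← Finset.sum_mul, sum_pi_prod, Finset.prod_eq_one fun t _ => (hq t).2, one_mul]

/-- Over a 1-spoofable channel user 1 cannot send even one bit. -/
theorem one_div_five_le_errorProb [Fintype X] [Fintype Y] (c : AdvIdCode X Y Z N₁ N₂ n) {W : MAC X Y Z}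
    (hW : W.IsOneSpoofable) (hN₁ : 2 ≤ N₁) (hN₂ : 1 ≤ N₂) : 1 / 5 ≤ c.errorProb W := by
  obtain ⟨Q, Q', hQ, hQ', hS⟩ := hW
  set e := c.errorProb W with he
  have he1 : c.errorAdvOne W ≤ e := (le_max_left _ _).trans (le_max_right _ _)
  have he2 : c.errorAdvTwo W ≤ e := (le_max_right _ _).trans (le_max_right _ _)
  have hN₁' : (2 : ℝ) ≤ N₁ := by exact_mod_cast hN₁
  have hN₂' : (1 : ℝ) ≤ N₂ := by exact_mod_cast hN₂
  -- User 1 sends `m'` while user 2 simulates the attack built from `m` and `k`. The first spoofing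
  -- identity makes this symmetric in `m`, `m'`; the second rewrites it as an attack by user 1
  -- against `k`.
  let μ : Fin N₁ → Fin N₁ → Fin N₂ → Fin n → Z → ℝ := fun m m' k t z =>
    ∑ y, Q (c.enc₁ m t) (c.enc₂ k t) y * W.prob (c.enc₁ m' t) y z
  have hμs : ∀ m m' k, μ m m' k = μ m' m k := fun m m' k => by
    funext t z
    exact (hS _ _ _ z).1
  have hμ' : ∀ m m' k, μ m m' k = fun t z =>
      ∑ x, Q' (c.enc₁ m t) (c.enc₁ m' t) x * W.prob x (c.enc₂ k t) z := fun m m' k => by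
    funext t z
    exact (hS _ _ _ z).1.trans (hS _ _ _ z).2
  have hμp : ∀ m m' k t, μ m m' k t ∈ stdSimplex ℝ Z := by
    intro m m' k t
    refine ⟨fun z => Finset.sum_nonneg fun y _ =>
      mul_nonneg ((hQ _ _).1 _) ((W.prob_mem _ _).1 _), ?_⟩
    simp only [μ]
    rw [Finset.sum_comm]
    simp only [← Finset.mul_sum, (W.prob_mem _ _).2, mul_one, (hQ _ _).2]
  have hA : ∀ m k, ∑ m', prodProb (μ m m' k) (c.errorEvent₁ m') ≤ N₁ * e := by
    intro m k
    have h : ∑ m', prodProb (μ m m' k) (c.errorEvent₁ m') =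
        ∑ y : Fin n → Y, (∏ t, Q (c.enc₁ m t) (c.enc₂ k t) (y t)) *
          ∑ m', W.probPow (c.enc₁ m') y (c.errorEvent₁ m') := by
      simp only [Finset.mul_sum]
      rw [Finset.sum_comm]
      refine Finset.sum_congr rfl fun m' _ => ?_
      exact (sum_prod_mul_prodProb (fun t => Q (c.enc₁ m t) (c.enc₂ k t))
        (fun t y => W.prob (c.enc₁ m' t) y) _).symm
    rw [h]
    refine sum_prod_mul_le (fun t => hQ _ _) _ fun y => ?_
    exact (c.sum_le_errorAdvTwo W (by omega) y).trans
      (mul_le_mul_of_nonneg_left he2 (by positivity))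
  have hC : ∀ m m', ∑ k, prodProb (μ m m' k) (c.errorEvent₂ k) ≤ N₂ * e := by
    intro m m'
    have h : ∑ k, prodProb (μ m m' k) (c.errorEvent₂ k) =
        ∑ x : Fin n → X, (∏ t, Q' (c.enc₁ m t) (c.enc₁ m' t) (x t)) *
          ∑ k, W.probPow x (c.enc₂ k) (c.errorEvent₂ k) := by
      simp only [Finset.mul_sum]
      rw [Finset.sum_comm]
      refine Finset.sum_congr rfl fun k _ => ?_
      rw [hμ']
      exact (sum_prod_mul_prodProb (fun t => Q' (c.enc₁ m t) (c.enc₁ m' t))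
        (fun t x => W.prob x (c.enc₂ k t)) _).symm
    rw [h]
    refine sum_prod_mul_le (fun t => hQ' _ _) _ fun x => ?_
    exact (c.sum_le_errorAdvOne W hN₂ x).trans
      (mul_le_mul_of_nonneg_left he1 (by positivity))
  -- A decoded pair has a first message different from `m` or from `m'`; accusing user 1 is wrong
  -- when user 2 attacks, and accusing user 2 is wrong when user 1 attacks.
  have hcov : ∀ m m' k, m ≠ m' → 1 ≤ prodProb (μ m m' k) (c.errorEvent₁ m') +
      prodProb (μ m m' k) (c.errorEvent₁ m) + prodProb (μ m m' k) (c.errorEvent₂ k) := by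
    intro m m' k hne
    rw [← prodProb_univ (hμp m m' k)]
    have hsub : (Set.univ : Set (Fin n → Z)) ⊆
        (c.errorEvent₁ m' ∪ c.errorEvent₁ m) ∪ c.errorEvent₂ k := by
      intro z _
      simp only [Set.mem_union, errorEvent₁, errorEvent₂, Set.mem_ofPred_eq]
      rcases hz : c.dec z with ⟨a, b⟩ | _ | _
      · left
        by_cases h : a = m
        · left; simp [h, hne]
        · right; simp [h]
      · simp
      · simp
    exact (prodProb_mono (hμp m m' k) hsub).trans ((prodProb_union_le (hμp m m' k) _ _).trans
      (add_le_add_left (prodProb_union_le (hμp m m' k) _ _) _))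
  -- sum over all pairs of distinct messages
  have e0 : ∀ m m' k, 0 ≤ prodProb (μ m m' k) (c.errorEvent₁ m') := fun m m' k =>
    prodProb_nonneg (hμp m m' k) _
  -- The diagonal is dropped only from the third term. Keeping it in the first two costs nothing and
  -- lets the full average over the honest message be used.
  have hpair : ∑ m : Fin N₁, ∑ m' : Fin N₁, ∑ _k : Fin N₂, ((if m = m' then 0 else 1 : ℝ)) ≤
      ∑ m, ∑ m', ∑ k, (prodProb (μ m m' k) (c.errorEvent₁ m') +
        prodProb (μ m m' k) (c.errorEvent₁ m) +
        (if m = m' then 0 else 1) * prodProb (μ m m' k) (c.errorEvent₂ k)) := by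
    refine Finset.sum_le_sum fun m _ => Finset.sum_le_sum fun m' _ =>
      Finset.sum_le_sum fun k _ => ?_
    by_cases h : m = m'
    · subst h
      simp only [if_true, zero_mul, add_zero]
      exact add_nonneg (e0 _ _ _) (e0 _ _ _)
    · simp only [h, if_false, one_mul]
      exact hcov m m' k h
  have hcount : ∀ m : Fin N₁, ∑ m', (if m = m' then 0 else 1 : ℝ) = N₁ - 1 := by
    intro m
    have : ∀ m' : Fin N₁, (if m = m' then 0 else 1 : ℝ) = 1 - (if m = m' then 1 else 0) :=
      fun m' => by split_ifs <;> norm_num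
    simp only [this, Finset.sum_sub_distrib, Finset.sum_ite_eq, Finset.mem_univ, if_true]
    simp
  have hL : ∑ m : Fin N₁, ∑ m' : Fin N₁, ∑ _k : Fin N₂, ((if m = m' then 0 else 1 : ℝ)) =
      N₁ * (N₁ - 1) * N₂ := by
    simp only [Finset.sum_const, Finset.card_univ, Fintype.card_fin, nsmul_eq_mul,
      ← Finset.mul_sum, hcount]
    ring
  have hR1 : ∑ m, ∑ m', ∑ k, prodProb (μ m m' k) (c.errorEvent₁ m') ≤ N₁ * (N₂ * (N₁ * e)) := by
    have : ∀ m, ∑ m', ∑ k, prodProb (μ m m' k) (c.errorEvent₁ m') ≤ N₂ * (N₁ * e) := by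
      intro m
      rw [Finset.sum_comm]
      refine (Finset.sum_le_sum fun k _ => hA m k).trans ?_
      simp
    refine (Finset.sum_le_sum fun m _ => this m).trans ?_
    simp
  have hR2 : ∑ m, ∑ m', ∑ k, prodProb (μ m m' k) (c.errorEvent₁ m) ≤ N₁ * (N₂ * (N₁ * e)) := by
    rw [Finset.sum_comm]
    refine le_of_eq_of_le ?_ hR1
    refine Finset.sum_congr rfl fun m _ => Finset.sum_congr rfl fun m' _ =>
      Finset.sum_congr rfl fun k _ => by rw [hμs]
  have hR3 : ∑ m, ∑ m', ∑ k, (if m = m' then 0 else 1) * prodProb (μ m m' k) (c.errorEvent₂ k)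
      ≤ N₁ * (N₁ - 1) * (N₂ * e) := by
    have : ∀ m, ∑ m', ∑ k, (if m = m' then 0 else 1) * prodProb (μ m m' k) (c.errorEvent₂ k) ≤
        (N₁ - 1) * (N₂ * e) := by
      intro m
      rw [← hcount m, Finset.sum_mul]
      refine Finset.sum_le_sum fun m' _ => ?_
      rw [← Finset.mul_sum]
      exact mul_le_mul_of_nonneg_left (hC m m') (by split_ifs <;> norm_num)
    refine (Finset.sum_le_sum fun m _ => this m).trans ?_
    simp [mul_assoc]
  simp only [Finset.sum_add_distrib] at hpair
  rw [hL] at hpair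
  have hfin : (N₁ : ℝ) * N₂ * (N₁ - 1) ≤ N₁ * N₂ * (2 * N₁ * e + (N₁ - 1) * e) := by
    calc (N₁ : ℝ) * N₂ * (N₁ - 1) = N₁ * (N₁ - 1) * N₂ := by ring
      _ ≤ _ := hpair.trans (add_le_add (add_le_add hR1 hR2) hR3)
      _ = _ := by ring
  have h2 := le_of_mul_le_mul_left hfin (by positivity)
  by_contra! hlt
  -- The inequality reads `N₁ - 1 ≤ (3 * N₁ - 1) * e`, and `(N₁ - 1) / (3 * N₁ - 1)` is smallest at
  -- `N₁ = 2`, where it is `1/5`.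
  nlinarith

end AdvIdCode

/-! ### Joint types. -/

section Empirical

variable {V : Type*} {n : ℕ}

open Classical in
/-- The empirical distribution (type) of a sequence. -/
noncomputable def empirical (v : Fin n → V) (a : V) : ℝ :=
  (∑ t, if v t = a then 1 else 0) / n

theorem sum_empirical_mul [Fintype V] (v : Fin n → V) (h : V → ℝ) :
    ∑ a, empirical v a * h a = (∑ t, h (v t)) / n := by
  classical
  simp only [empirical, div_mul_eq_mul_div, ← Finset.sum_div, Finset.sum_mul]
  rw [Finset.sum_comm]
  simp

theorem empirical_mem_stdSimplex [Fintype V] (hn : 0 < n) (v : Fin n → V) :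
    empirical v ∈ stdSimplex ℝ V := by
  classical
  refine ⟨fun a => div_nonneg (Finset.sum_nonneg fun t _ => by split_ifs <;> norm_num)
    (Nat.cast_nonneg n), ?_⟩
  have h := sum_empirical_mul v fun _ => 1
  simp only [mul_one, Finset.sum_const, Finset.card_univ, Fintype.card_fin, nsmul_eq_mul] at h
  rw [h, div_self]
  exact_mod_cast hn.ne'

theorem empirical_assoc {A B C : Type*} (f : Fin n → A) (g : Fin n → B) (h : Fin n → C)
    (a : A) (b : B) (c : C) : empirical (fun t => ((f t, g t), h t)) ((a, b), c) =
      empirical (fun t => (f t, g t, h t)) (a, b, c) := by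
  refine congrArg (· / (n : ℝ)) (Finset.sum_congr rfl fun t _ => ?_)
  by_cases h₁ : f t = a <;> by_cases h₂ : g t = b <;> by_cases h₃ : h t = c <;> simp [h₁, h₂, h₃]

end Empirical

/-! ### Consistency tests and non-spoofability. -/

namespace MAC

variable {X Y Z U : Type*} [Fintype X] [Fintype Z] {n : ℕ}

open Classical in
/-- The deviation of `(u, x, z)` from the behaviour expected when `x` is drawn uniformly and
independently of `(u, y)`, and `z` is the channel output for the inputs `x` and `y`. -/
noncomputable def deviation (W : MAC X Y Z) (x : Fin n → X) (y : Fin n → Y) (u : Fin n → U)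
    (z : Fin n → Z) (S : Set U) (a : X) (e : Z) : ℝ :=
  ∑ t, if u t ∈ S then
    (if x t = a ∧ z t = e then 1 else 0) - W.prob a (y t) e / Fintype.card X else 0

/-- All the deviations are at most `δ n`. -/
def Consistent (W : MAC X Y Z) (δ : ℝ) (x : Fin n → X) (y : Fin n → Y) (u : Fin n → U)
    (z : Fin n → Z) : Prop :=
  ∀ S a e, |W.deviation x y u z S a e| ≤ δ * n

-- Taking for `S` a fibre of `π` turns a deviation into a comparison of joint types. The projection
-- discards the side information that a given application does not need.
open Classical in
theorem Consistent.abs_sub_le [Fintype Y] {V : Type*} [Fintype V] {W : MAC X Y Z} {δ : ℝ}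
    {x : Fin n → X} {y : Fin n → Y} {u : Fin n → U} {z : Fin n → Z} (hn : 0 < n)
    (h : W.Consistent δ x y u z) (π : U → V) (a : X) (e : Z) (b : V) :
    |(∑ t, if π (u t) = b ∧ x t = a ∧ z t = e then 1 else 0) / (n : ℝ) -
      (∑ d, empirical (fun t => (π (u t), y t)) (b, d) * W.prob a d e) / Fintype.card X| ≤ δ := by
  have hn' : (0 : ℝ) < n := by exact_mod_cast hn
  have h1 := h {u | π u = b} a e
  have h2 : ∑ d, empirical (fun t => (π (u t), y t)) (b, d) * W.prob a d e =
      (∑ t, if π (u t) = b then W.prob a (y t) e else 0) / n := by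
    rw [← sum_empirical_mul (fun t => (π (u t), y t))
      (fun v => if v.1 = b then W.prob a v.2 e else 0), Fintype.sum_prod_type,
      Finset.sum_eq_single b]
    · simp
    · intro b' _ hb'
      simp [hb']
    · simp
  have h3 : W.deviation x y u z {u | π u = b} a e =
      n * ((∑ t, if π (u t) = b ∧ x t = a ∧ z t = e then 1 else 0) / (n : ℝ) -
      (∑ d, empirical (fun t => (π (u t), y t)) (b, d) * W.prob a d e) / Fintype.card X) := by
    rw [h2, mul_sub, mul_div_cancel₀ _ hn'.ne', div_right_comm, mul_div_cancel₀ _ hn'.ne',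
      Finset.sum_div, ← Finset.sum_sub_distrib, deviation]
    refine Finset.sum_congr rfl fun t _ => ?_
    by_cases hb : π (u t) = b <;> simp [hb]
  rw [h3, abs_mul, abs_of_pos hn', mul_comm δ] at h1
  exact le_of_mul_le_mul_left h1 hn'

variable [Fintype Y]

/-- If three joint distributions explain the same output in the three possible ways, then the
channel is 1-spoofable. -/
theorem isOneSpoofable_of_eq [Nonempty X] [Nonempty Y] {W : MAC X Y Z} {P P' : X × Y × Y → ℝ}
    {R : X × X × X → ℝ} (hP : P ∈ stdSimplex ℝ (X × Y × Y)) (hP' : P' ∈ stdSimplex ℝ (X × Y × Y))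
    (hR : R ∈ stdSimplex ℝ (X × X × X))
    (h₁ : ∀ a b c e, (∑ d, P (b, c, d) * W.prob a d e) / Fintype.card X =
      (∑ d, P' (a, c, d) * W.prob b d e) / Fintype.card X)
    (h₂ : ∀ a b c e, (∑ d, P' (a, c, d) * W.prob b d e) / Fintype.card X =
      (∑ d, R (a, b, d) * W.prob d c e) / Fintype.card Y) : W.IsOneSpoofable := by
  set k : ℝ := (Fintype.card X : ℝ) with hk
  set l : ℝ := (Fintype.card Y : ℝ) with hl
  have hk0 : 0 < k := by rw [hk]; exact_mod_cast Fintype.card_pos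
  have hl0 : 0 < l := by rw [hl]; exact_mod_cast Fintype.card_pos
  have m₁ : ∀ a b c, (∑ d, P (b, c, d)) / k = (∑ d, P' (a, c, d)) / k := by
    intro a b c
    have := Finset.sum_congr (rfl : (Finset.univ : Finset Z) = _) fun e _ => h₁ a b c e
    rw [← Finset.sum_div, ← Finset.sum_div] at this
    have s₁ := W.sum_sum_mul_prob (fun d => P (b, c, d)) (fun _ => a) id
    have s₂ := W.sum_sum_mul_prob (fun d => P' (a, c, d)) (fun _ => b) id
    exact (congrArg (· / k) s₁).symm.trans (this.trans (congrArg (· / k) s₂))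
  have m₂ : ∀ a b c, (∑ d, P' (a, c, d)) / k = (∑ d, R (a, b, d)) / l := by
    intro a b c
    have := Finset.sum_congr (rfl : (Finset.univ : Finset Z) = _) fun e _ => h₂ a b c e
    rw [← Finset.sum_div, ← Finset.sum_div] at this
    have s₁ := W.sum_sum_mul_prob (fun d => P' (a, c, d)) (fun _ => b) id
    have s₂ := W.sum_sum_mul_prob (fun d => R (a, b, d)) id (fun _ => c)
    exact (congrArg (· / k) s₁).symm.trans (this.trans (congrArg (· / l) s₂))
  obtain ⟨a₀⟩ := ‹Nonempty X›
  obtain ⟨c₀⟩ := ‹Nonempty Y›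
  -- Summing over outputs equates functions of `(b, c)`, of `(a, c)` and of `(a, b)`, so all three
  -- are one constant: the pair marginals of `P`, `P'` and `R` are uniform.
  set κ := (∑ d, P (a₀, c₀, d)) / k with hκ
  have c₁ : ∀ b c, (∑ d, P (b, c, d)) / k = κ := fun b c => by
    rw [m₁ a₀ b c, m₂ a₀ a₀ c, ← m₂ a₀ a₀ c₀, ← m₁ a₀ a₀ c₀]
  have c₂ : ∀ a c, (∑ d, P' (a, c, d)) / k = κ := fun a c => by rw [← m₁ a a₀ c, c₁]
  have c₃ : ∀ a b, (∑ d, R (a, b, d)) / l = κ := fun a b => by rw [← m₂ a b c₀, c₂]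
  have hκ1 : κ * (k * k * l) = 1 := by
    have := hP.2
    simp only [Fintype.sum_prod_type, fun b c => (div_eq_iff hk0.ne').1 (c₁ b c)] at this
    simp only [Finset.sum_const, Finset.card_univ, nsmul_eq_mul, ← hk, ← hl] at this
    linarith
  have s₁ : ∀ b c, ∑ d, P (b, c, d) = κ * k := fun b c => (div_eq_iff hk0.ne').1 (c₁ b c)
  have s₂ : ∀ b c, ∑ d, P' (b, c, d) = κ * k := fun b c => (div_eq_iff hk0.ne').1 (c₂ b c)
  have s₃ : ∀ b c, ∑ d, R (b, c, d) = κ * l := fun b c => (div_eq_iff hl0.ne').1 (c₃ b c)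
  have e₁ : ∀ a b c e, ∑ d, P (b, c, d) * W.prob a d e = ∑ d, P' (a, c, d) * W.prob b d e :=
    fun a b c e => (div_left_inj' hk0.ne').1 (h₁ a b c e)
  have e₂ : ∀ a b c e, l * ∑ d, P' (a, c, d) * W.prob b d e =
      k * ∑ d, R (a, b, d) * W.prob d c e := fun a b c e => by
    have := (div_eq_div_iff hk0.ne' hl0.ne').1 (h₂ a b c e)
    linarith
  have ex₁ : ∀ a b c e, ∑ d, (k * l / 2 * (P (b, c, d) + P' (b, c, d))) * W.prob a d e =
      k * l / 2 * (∑ d, P (b, c, d) * W.prob a d e + ∑ d, P' (b, c, d) * W.prob a d e) := by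
    intro a b c e
    rw [← Finset.sum_add_distrib, Finset.mul_sum]
    exact Finset.sum_congr rfl fun d _ => by ring
  have ex₂ : ∀ a b c e, ∑ d, (k * k / 2 * (R (a, b, d) + R (b, a, d))) * W.prob d c e =
      k * k / 2 * (∑ d, R (a, b, d) * W.prob d c e + ∑ d, R (b, a, d) * W.prob d c e) := by
    intro a b c e
    rw [← Finset.sum_add_distrib, Finset.mul_sum]
    exact Finset.sum_congr rfl fun d _ => by ring
  -- Uniform marginals make conditioning a multiplication by `k * l` or `k * k`. The definition
  -- wants a single `Q`, so the conditionals of `P` and `P'` are averaged; `R` is symmetrised to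
  -- match.
  refine ⟨fun b c d => k * l / 2 * (P (b, c, d) + P' (b, c, d)),
    fun b a d => k * k / 2 * (R (a, b, d) + R (b, a, d)), fun b c => ⟨fun d => ?_, ?_⟩,
    fun b a => ⟨fun d => ?_, ?_⟩, fun a b c e => ⟨?_, ?_⟩⟩
  · exact mul_nonneg (by positivity) (add_nonneg (hP.1 _) (hP'.1 _))
  · rw [← Finset.mul_sum, Finset.sum_add_distrib, s₁, s₂]
    linarith
  · exact mul_nonneg (by positivity) (add_nonneg (hR.1 _) (hR.1 _))
  · rw [← Finset.mul_sum, Finset.sum_add_distrib, s₃, s₃]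
    linarith
  · rw [ex₁, ex₁, e₁ a b, e₁ b a, add_comm]
  · rw [ex₁, ex₂, e₁ b a]
    linear_combination (k / 2) * e₂ a b c e + (k / 2) * e₂ b a c e

/-- The largest violation of the identities is continuous in the three distributions and never zero,
by `isOneSpoofable_of_eq`, so it has a positive minimum on the compact product of simplices. -/
theorem exists_gap_of_not_isOneSpoofable [Nonempty X] [Nonempty Y] {W : MAC X Y Z}
    (hW : ¬ W.IsOneSpoofable) : ∃ ε > 0, ∀ P ∈ stdSimplex ℝ (X × Y × Y),
      ∀ P' ∈ stdSimplex ℝ (X × Y × Y), ∀ R ∈ stdSimplex ℝ (X × X × X), ∃ a b c e,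
        ε < |(∑ d, P (b, c, d) * W.prob a d e) / Fintype.card X -
          (∑ d, P' (a, c, d) * W.prob b d e) / Fintype.card X| ∨
        ε < |(∑ d, P' (a, c, d) * W.prob b d e) / Fintype.card X -
          (∑ d, R (a, b, d) * W.prob d c e) / Fintype.card Y| := by
  let F : (X × Y × Y → ℝ) × (X × Y × Y → ℝ) × (X × X × X → ℝ) → (X × X × Y × Z → ℝ × ℝ) :=
    fun T i => ((∑ d, T.1 (i.2.1, i.2.2.1, d) * W.prob i.1 d i.2.2.2) / Fintype.card X -
        (∑ d, T.2.1 (i.1, i.2.2.1, d) * W.prob i.2.1 d i.2.2.2) / Fintype.card X,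
      (∑ d, T.2.1 (i.1, i.2.2.1, d) * W.prob i.2.1 d i.2.2.2) / Fintype.card X -
        (∑ d, T.2.2 (i.1, i.2.1, d) * W.prob d i.2.2.1 i.2.2.2) / Fintype.card Y)
  have hF : Continuous F := by fun_prop
  have hK : IsCompact (stdSimplex ℝ (X × Y × Y) ×ˢ stdSimplex ℝ (X × Y × Y) ×ˢ
      stdSimplex ℝ (X × X × X)) :=
    (isCompact_stdSimplex ℝ _).prod ((isCompact_stdSimplex ℝ _).prod (isCompact_stdSimplex ℝ _))
  have hne : (stdSimplex ℝ (X × Y × Y) ×ˢ stdSimplex ℝ (X × Y × Y) ×ˢ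
      stdSimplex ℝ (X × X × X)).Nonempty := by
    classical
    obtain ⟨a⟩ := ‹Nonempty X›
    obtain ⟨b⟩ := ‹Nonempty Y›
    exact ⟨(Pi.single (a, b, b) 1, Pi.single (a, b, b) 1, Pi.single (a, a, a) 1),
      single_mem_stdSimplex ℝ _, single_mem_stdSimplex ℝ _, single_mem_stdSimplex ℝ _⟩
  obtain ⟨T, ⟨hT₁, hT₂, hT₃⟩, hmin⟩ := hK.exists_isMinOn hne hF.norm.continuousOn
  have hpos : 0 < ‖F T‖ := by
    rw [norm_pos_iff]
    intro h0
    refine hW (isOneSpoofable_of_eq hT₁ hT₂ hT₃ (fun a b c e => ?_) fun a b c e => ?_)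
    · exact sub_eq_zero.1 (congrArg Prod.fst (congrFun h0 (a, b, c, e)))
    · exact sub_eq_zero.1 (congrArg Prod.snd (congrFun h0 (a, b, c, e)))
  refine ⟨‖F T‖ / 2, half_pos hpos, fun P hP P' hP' R hR => ?_⟩
  by_contra! hcon
  have h1 : ‖F T‖ ≤ ‖F (P, P', R)‖ := hmin (show (P, P', R) ∈ _ from ⟨hP, hP', hR⟩)
  have h2 : ‖F (P, P', R)‖ ≤ ‖F T‖ / 2 := by
    refine (pi_norm_le_iff_of_nonneg (half_pos hpos).le).2 fun i => ?_
    obtain ⟨a, b, c, e⟩ := i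
    exact max_le (hcon a b c e).1 (hcon a b c e).2
  linarith

/-- Over a channel that is not 1-spoofable, no output is consistent with two codewords of user 1
and at the same time with a codeword of user 2. -/
theorem exists_not_consistent [Nonempty X] [Nonempty Y] {W : MAC X Y Z}
    (hW : ¬ W.IsOneSpoofable) : ∃ δ > 0, ∀ (n : ℕ), 0 < n →
      ∀ (x x' x₁ : Fin n → X) (y y₁ y₂ : Fin n → Y) (z : Fin n → Z) (v : Fin n → Y),
        W.Consistent δ x y₁ (fun t => (x' t, y t, y t)) z →
        W.Consistent δ x' y₂ (fun t => (x t, y t, y t)) z →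
        ¬ W.swap.Consistent δ y x₁ (fun t => (v t, x t, x' t)) z := by
  classical
  obtain ⟨ε, hε, hgap⟩ := exists_gap_of_not_isOneSpoofable hW
  -- Each of the three expressions is within `ε / 2` of the same joint type of `(x, x', y, z)`, so
  -- no two of them differ by more than `ε`.
  refine ⟨ε / 2, half_pos hε, fun n hn x x' x₁ y y₁ y₂ z v h₁ h₂ h₃ => ?_⟩
  obtain ⟨a, b, c, e, h⟩ := hgap _ (empirical_mem_stdSimplex hn fun t => (x' t, y t, y₁ t))
    _ (empirical_mem_stdSimplex hn fun t => (x t, y t, y₂ t))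
    _ (empirical_mem_stdSimplex hn fun t => (x t, x' t, x₁ t))
  have q₁ := h₁.abs_sub_le hn (fun u => (u.1, u.2.1)) a e (b, c)
  have q₂ := h₂.abs_sub_le hn (fun u => (u.1, u.2.1)) b e (a, c)
  have q₃ := h₃.abs_sub_le hn (fun u => (u.2.1, u.2.2)) c e (a, b)
  simp only [empirical_assoc, Prod.mk.injEq, and_assoc, swap] at q₁ q₂ q₃
  have r₂ : (∑ t, if x t = a ∧ y t = c ∧ x' t = b ∧ z t = e then 1 else 0 : ℝ) =
      ∑ t, if x' t = b ∧ y t = c ∧ x t = a ∧ z t = e then 1 else 0 :=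
    Finset.sum_congr rfl fun t _ => if_congr (by tauto) rfl rfl
  have r₃ : (∑ t, if x t = a ∧ x' t = b ∧ y t = c ∧ z t = e then 1 else 0 : ℝ) =
      ∑ t, if x' t = b ∧ y t = c ∧ x t = a ∧ z t = e then 1 else 0 :=
    Finset.sum_congr rfl fun t _ => if_congr (by tauto) rfl rfl
  rw [r₂] at q₂
  rw [r₃] at q₃
  rw [abs_le] at q₁ q₂ q₃
  rcases h with h | h <;> rcases lt_abs.1 h with h | h <;>
    linarith [q₁.1, q₁.2, q₂.1, q₂.2, q₃.1, q₃.2]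

end MAC

/-! ### Random codebooks with few bad codewords. -/

section RandomCode

variable {ι A : Type*} [Fintype ι] [Fintype A]

/-- Exchanging the fresh value with the old coordinate is an involution, so resampling one
coordinate preserves the uniform distribution. -/
theorem sum_sum_update [DecidableEq ι] (m : ι) (φ : (ι → A) → ℝ) :
    ∑ f : ι → A, ∑ a, φ (Function.update f m a) = Fintype.card A * ∑ f, φ f := by
  let e : (ι → A) × A → (ι → A) × A := fun p => (Function.update p.1 m p.2, p.1 m)
  have he : Function.Involutive e := fun p => by
    simp only [e, Function.update_idem, Function.update_self, Function.update_eq_self]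
  have h := Equiv.sum_comp he.toPerm fun p => φ p.1
  simp only [Function.Involutive.coe_toPerm, e] at h
  rw [← Fintype.sum_prod_type' fun f a => φ (Function.update f m a), h, Fintype.sum_prod_type]
  simp [Finset.mul_sum]

open Classical in
/-- If, given the earlier values, each `G m` has conditional probability at most `q`, then all the
`G m` with `m ∈ B` occur together with probability at most `q ^ #B`. -/
theorem card_forall_mem_le [LinearOrder ι] [Nonempty A] {G : ι → (ι → A) → Prop} {q : ℝ}
    (hG : ∀ m f f', (∀ i ≤ m, f i = f' i) → G m f → G m f')
    (hq : ∀ m f, (Finset.card {a | G m (Function.update f m a)} : ℝ) ≤ q * Fintype.card A)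
    (B : Finset ι) :
    (Finset.card {f | ∀ m ∈ B, G m f} : ℝ) ≤ q ^ B.card * Fintype.card (ι → A) := by
  have hA : (0 : ℝ) < Fintype.card A := by exact_mod_cast Fintype.card_pos
  have hq0 : ∀ _ : ι, 0 ≤ q := fun m => by
    have f : ι → A := fun _ => Classical.arbitrary A
    exact nonneg_of_mul_nonneg_left ((Nat.cast_nonneg _).trans (hq m f)) hA
  induction B using Finset.induction_on_max with
  | empty => simp
  | insert m B hm ih =>
    have hmB : m ∉ B := fun h => lt_irrefl _ (hm m h)
    rw [Finset.card_insert_of_notMem hmB, pow_succ]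
    refine le_of_mul_le_mul_left ?_ hA
    have hcongr : ∀ f a, (∀ i ∈ insert m B, G i (Function.update f m a)) →
        (∀ i ∈ B, G i f) ∧ G m (Function.update f m a) := fun f a h =>
      ⟨fun i hi => hG i _ _ (fun j hj => by
        rw [Function.update_of_ne (hj.trans_lt (hm i hi)).ne]) (h i (Finset.mem_insert_of_mem hi)),
        h m (Finset.mem_insert_self _ _)⟩
    calc (Fintype.card A : ℝ) * (Finset.card {f | ∀ i ∈ insert m B, G i f} : ℝ)
        = Fintype.card A * ∑ f : ι → A, if ∀ i ∈ insert m B, G i f then 1 else 0 := by simp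
      _ = ∑ f : ι → A, ∑ a, if ∀ i ∈ insert m B, G i (Function.update f m a) then 1 else 0 :=
          (sum_sum_update m fun f => if ∀ i ∈ insert m B, G i f then (1 : ℝ) else 0).symm
      _ ≤ ∑ f : ι → A, (if ∀ i ∈ B, G i f then 1 else 0) *
            ∑ a, if G m (Function.update f m a) then 1 else 0 := by
          refine Finset.sum_le_sum fun f _ => ?_
          rw [Finset.mul_sum]
          refine Finset.sum_le_sum fun a _ => ?_
          by_cases h : ∀ i ∈ insert m B, G i (Function.update f m a)
          · rw [if_pos h, if_pos (hcongr f a h).1, if_pos (hcongr f a h).2, one_mul]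
          · rw [if_neg h]
            exact mul_nonneg (by split_ifs <;> norm_num) (by split_ifs <;> norm_num)
      _ ≤ ∑ f : ι → A, (if ∀ i ∈ B, G i f then 1 else 0) * (q * Fintype.card A) := by
          refine Finset.sum_le_sum fun f _ => mul_le_mul_of_nonneg_left ?_
            (by split_ifs <;> norm_num)
          simpa using hq m f
      _ = (q * Fintype.card A) * (Finset.card {f | ∀ i ∈ B, G i f} : ℝ) := by
          rw [← Finset.sum_mul, mul_comm]; simp
      _ ≤ (q * Fintype.card A) * (q ^ B.card * Fintype.card (ι → A)) :=
          mul_le_mul_of_nonneg_left ih (mul_nonneg (hq0 m) hA.le)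
      _ = Fintype.card A * (q ^ B.card * q * Fintype.card (ι → A)) := by ring

-- Union bound over the `k`-element sets of indices, of which there are at most `(Fintype.card ι) ^
-- k`.
open Classical in
theorem card_le_card_filter_le [LinearOrder ι] [Nonempty A] {G : ι → (ι → A) → Prop} {q : ℝ}
    (hq0 : 0 ≤ q) (hG : ∀ m f f', (∀ i ≤ m, f i = f' i) → G m f → G m f')
    (hq : ∀ m f, (Finset.card {a | G m (Function.update f m a)} : ℝ) ≤ q * Fintype.card A)
    (k : ℕ) :
    (Finset.card {f | k ≤ Finset.card {m | G m f}} : ℝ) ≤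
      (Fintype.card ι * q) ^ k * Fintype.card (ι → A) := by
  have hsub : ({f | k ≤ Finset.card {m | G m f}} : Finset (ι → A)) ⊆
      (Finset.powersetCard k Finset.univ).biUnion fun B => {f | ∀ m ∈ B, G m f} := by
    intro f hf
    obtain ⟨B, hB, hBk⟩ := Finset.exists_subset_card_eq (Finset.mem_filter.1 hf).2
    refine Finset.mem_biUnion.2 ⟨B, Finset.mem_powersetCard.2 ⟨Finset.subset_univ _, hBk⟩, ?_⟩
    exact Finset.mem_filter.2 ⟨Finset.mem_univ _, fun m hm => (Finset.mem_filter.1 (hB hm)).2⟩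
  have h1 : (Finset.card {f | k ≤ Finset.card {m | G m f}} : ℝ) ≤
      ∑ B ∈ Finset.powersetCard k Finset.univ, (Finset.card {f | ∀ m ∈ B, G m f} : ℝ) := by
    exact_mod_cast (Finset.card_le_card hsub).trans Finset.card_biUnion_le
  refine h1.trans ((Finset.sum_le_sum fun B hB => ?_ : _ ≤
    ∑ _B ∈ Finset.powersetCard k (Finset.univ : Finset ι),
      q ^ k * (Fintype.card (ι → A) : ℝ)).trans ?_)
  · rw [← (Finset.mem_powersetCard.1 hB).2]
    exact card_forall_mem_le hG hq B
  · rw [Finset.sum_const, Finset.card_powersetCard, nsmul_eq_mul, Finset.card_univ, mul_pow,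
      mul_assoc]
    refine mul_le_mul_of_nonneg_right ?_ (by positivity)
    exact_mod_cast Nat.choose_le_pow _ _

-- Restricting to earlier indices makes the event at `m` depend only on coordinates up to `m`, so
-- its conditional probability is at most `Fintype.card ι * q`.
open Classical in
theorem card_le_card_bad_below_le [LinearOrder ι] [Nonempty A] {Bad : A → A → Prop} {q : ℝ}
    (hq0 : 0 ≤ q) (hq : ∀ b, (Finset.card {a | Bad a b} : ℝ) ≤ q * Fintype.card A) (k : ℕ) :
    (Finset.card {f : ι → A | k ≤ Finset.card {m | ∃ m' < m, Bad (f m) (f m')}} : ℝ) ≤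
      (Fintype.card ι * (Fintype.card ι * q)) ^ k * Fintype.card (ι → A) := by
  convert card_le_card_filter_le (q := Fintype.card ι * q)
    (G := fun m f => ∃ m' < m, Bad (f m) (f m')) (by positivity) (fun m f f' h => ?_)
    (fun m f => ?_) k
  · rintro ⟨m', hm', hb⟩
    exact ⟨m', hm', by rwa [← h m le_rfl, ← h m' hm'.le]⟩
  · have hsub : ({a | ∃ m' < m, Bad (Function.update f m a m) (Function.update f m a m')} :
        Finset A) ⊆ Finset.univ.biUnion fun m' => {a | Bad a (f m')} := by
      intro a ha
      obtain ⟨m', hm', hb⟩ := (Finset.mem_filter.1 ha).2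
      rw [Function.update_self, Function.update_of_ne hm'.ne] at hb
      exact Finset.mem_biUnion.2 ⟨m', Finset.mem_univ _,
        Finset.mem_filter.2 ⟨Finset.mem_univ _, hb⟩⟩
    have h1 : (Finset.card {a | ∃ m' < m, Bad (Function.update f m a m)
        (Function.update f m a m')} : ℝ) ≤ ∑ m', (Finset.card {a | Bad a (f m')} : ℝ) := by
      rw [← Nat.cast_sum, Nat.cast_le]
      exact (Finset.card_le_card hsub).trans Finset.card_biUnion_le
    have h2 : ∑ m', (Finset.card {a | Bad a (f m')} : ℝ) ≤
        Fintype.card ι * q * Fintype.card A := by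
      refine (Finset.sum_le_sum fun m' _ => hq (f m')).trans (le_of_eq ?_)
      simp [mul_assoc]
    refine le_of_eq_of_le ?_ (h1.trans h2)
    congr!

open Classical in
/-- In a random codebook, with overwhelming probability only few codewords are in bad relation to
another codeword. -/
theorem card_le_card_bad_le [LinearOrder ι] [Nonempty A] {Bad : A → A → Prop} {q : ℝ}
    (hq0 : 0 ≤ q) (hq : ∀ b, (Finset.card {a | Bad a b} : ℝ) ≤ q * Fintype.card A) (k : ℕ) :
    (Finset.card {f : ι → A | 2 * k ≤ Finset.card {m | ∃ m', m' ≠ m ∧ Bad (f m) (f m')}} : ℝ) ≤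
      2 * ((Fintype.card ι * (Fintype.card ι * q)) ^ k * Fintype.card (ι → A)) := by
  have h1 := card_le_card_bad_below_le (ι := ι) hq0 hq k
  have h2 : (Finset.card {f : ι → A | k ≤ Finset.card {m | ∃ m' > m, Bad (f m) (f m')}} : ℝ) ≤
      (Fintype.card ι * (Fintype.card ι * q)) ^ k * Fintype.card (ι → A) :=
    -- Later indices are earlier ones in the reversed order.
    card_le_card_bad_below_le (ι := ιᵒᵈ) hq0 hq k
  have hsub : ({f : ι → A | 2 * k ≤ Finset.card {m | ∃ m', m' ≠ m ∧ Bad (f m) (f m')}} :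
      Finset (ι → A)) ⊆
      ({f | k ≤ Finset.card {m | ∃ m' < m, Bad (f m) (f m')}} : Finset (ι → A)) ∪
      ({f | k ≤ Finset.card {m | ∃ m' > m, Bad (f m) (f m')}} : Finset (ι → A)) := by
    intro f hf
    have hs : ({m | ∃ m', m' ≠ m ∧ Bad (f m) (f m')} : Finset ι) ⊆
        ({m | ∃ m' < m, Bad (f m) (f m')} : Finset ι) ∪
        ({m | ∃ m' > m, Bad (f m) (f m')} : Finset ι) := by
      intro m hm
      obtain ⟨m', hne, hb⟩ := (Finset.mem_filter.1 hm).2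
      rw [Finset.mem_union, Finset.mem_filter, Finset.mem_filter]
      rcases lt_or_gt_of_ne hne with h | h
      · exact Or.inl ⟨Finset.mem_univ _, m', h, hb⟩
      · exact Or.inr ⟨Finset.mem_univ _, m', h, hb⟩
    have h3 := (Finset.card_le_card hs).trans (Finset.card_union_le _ _)
    have h4 := (Finset.mem_filter.1 hf).2
    rw [Finset.mem_union, Finset.mem_filter, Finset.mem_filter]
    by_contra! hcon
    have h5 := hcon.1 (Finset.mem_univ _)
    have h6 := hcon.2 (Finset.mem_univ _)
    omega
  have h3 : (Finset.card {f : ι → A | 2 * k ≤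
      Finset.card {m | ∃ m', m' ≠ m ∧ Bad (f m) (f m')}} : ℝ) ≤
      (Finset.card {f : ι → A | k ≤ Finset.card {m | ∃ m' < m, Bad (f m) (f m')}} : ℝ) +
      (Finset.card {f : ι → A | k ≤ Finset.card {m | ∃ m' > m, Bad (f m) (f m')}} : ℝ) := by
    exact_mod_cast (Finset.card_le_card hsub).trans (Finset.card_union_le _ _)
  linarith

end RandomCode

/-! ### Typicality of random inputs and outputs. -/

namespace MAC

variable {X Y Z U : Type*} [Fintype X] [Fintype Z] {n : ℕ}

open Classical in
/-- The deviation of `(u, x)` from the behaviour expected when `x` is drawn uniformly and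
independently of `(u, y)`. -/
noncomputable def inputDeviation (W : MAC X Y Z) (x : Fin n → X) (y : Fin n → Y) (u : Fin n → U)
    (S : Set U) (a : X) (e : Z) : ℝ :=
  ∑ t, if u t ∈ S then
    W.prob a (y t) e * ((if x t = a then 1 else 0) - 1 / Fintype.card X) else 0

/-- All the deviations are at most `δ n`. -/
def Regular (W : MAC X Y Z) (δ : ℝ) (x : Fin n → X) (y : Fin n → Y) (u : Fin n → U) : Prop :=
  ∀ S a e, |W.inputDeviation x y u S a e| ≤ δ * n

theorem Consistent.mono {W : MAC X Y Z} {δ δ' : ℝ} {x : Fin n → X} {y : Fin n → Y}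
    {u : Fin n → U} {z : Fin n → Z} (h : W.Consistent δ x y u z) (hδ : δ ≤ δ') :
    W.Consistent δ' x y u z :=
  fun S a e => (h S a e).trans (mul_le_mul_of_nonneg_right hδ (Nat.cast_nonneg n))

/-- Regular inputs produce a consistent output with high probability. -/
theorem probPow_not_consistent_le [Fintype U] (W : MAC X Y Z) {δ : ℝ} (hδ0 : 0 ≤ δ) (hδ : δ ≤ 2)
    {x : Fin n → X} {y : Fin n → Y} {u : Fin n → U} (h : W.Regular δ x y u) :
    W.probPow x y {z | ¬ W.Consistent (2 * δ) x y u z} ≤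
      Fintype.card (Set U × X × Z) * (2 * Real.exp (-(n * δ ^ 2 / 4))) := by
  classical
  rw [probPow_eq_prodProb]
  let g : Set U × X × Z → Fin n → Z → ℝ := fun i t e =>
    if u t ∈ i.1 ∧ x t = i.2.1 then
      (if e = i.2.2 then 1 else 0) - W.prob i.2.1 (y t) i.2.2 else 0
  refine (prodProb_mono (fun t => W.prob_mem _ _) ?_).trans
    (prodProb_iUnion_le_card_mul (fun t => W.prob_mem _ _)
      (fun i => {z | δ * n < |∑ t, g i t (z t)|}) fun i =>
        prodProb_abs_sum_gt_le (fun t => W.prob_mem _ _) ?_ ?_ hδ0 hδ)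
  · intro z hz
    simp only [Set.mem_ofPred_eq, Consistent, not_forall, not_le] at hz
    obtain ⟨S, a, e, hz⟩ := hz
    refine Set.mem_iUnion.2 ⟨(S, a, e), ?_⟩
    -- The output noise given the inputs is separated from the irregularity of the input itself;
    -- each contributes at most `δ * n`, whence the factor `2`.
    have hsum : W.deviation x y u z S a e =
        ∑ t, g (S, a, e) t (z t) + W.inputDeviation x y u S a e := by
      rw [deviation, inputDeviation, ← Finset.sum_add_distrib]
      refine Finset.sum_congr rfl fun t _ => ?_
      by_cases h1 : u t ∈ S <;> by_cases h2 : x t = a <;> by_cases h3 : z t = e <;>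
        simp [g, h1, h2, h3] <;> ring
    rw [hsum] at hz
    have h1 := abs_add_le (∑ t, g (S, a, e) t (z t)) (W.inputDeviation x y u S a e)
    have h2 := h S a e
    simp only [Set.mem_ofPred_eq]
    linarith
  · intro t e
    have h0 := (W.prob_mem i.2.1 (y t)).1 i.2.2
    have h1 := W.prob_le_one i.2.1 (y t) i.2.2
    simp only [g]
    split_ifs <;> rw [abs_le] <;> constructor <;> linarith
  · intro t
    by_cases hc : u t ∈ i.1 ∧ x t = i.2.1
    · simp only [g, if_pos hc, mul_sub, Finset.sum_sub_distrib, ← Finset.sum_mul,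
        (W.prob_mem _ _).2, hc.2]
      simp
    · simp [g, if_neg hc]

open Classical in
/-- A uniformly random input is regular with high probability. -/
theorem card_not_regular_le [Fintype U] [Nonempty X] (W : MAC X Y Z) {δ : ℝ} (hδ0 : 0 ≤ δ)
    (hδ : δ ≤ 2) (y : Fin n → Y) (u : Fin n → U) :
    (Finset.card {x | ¬ W.Regular δ x y u} : ℝ) ≤
      Fintype.card (Set U × X × Z) * (2 * Real.exp (-(n * δ ^ 2 / 4))) *
        Fintype.card (Fin n → X) := by
  have hX : (0 : ℝ) < Fintype.card X := by exact_mod_cast Fintype.card_pos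
  have hX1 : (1 : ℝ) ≤ Fintype.card X := by exact_mod_cast Fintype.card_pos
  let p : Fin n → X → ℝ := fun _ _ => 1 / Fintype.card X
  have hp : ∀ t, p t ∈ stdSimplex ℝ X := fun t =>
    ⟨fun _ => by positivity, by simp [p, hX.ne']⟩
  have hcard : (Finset.card {x | ¬ W.Regular δ x y u} : ℝ) =
      prodProb p {x | ¬ W.Regular δ x y u} * Fintype.card (Fin n → X) := by
    simp only [prodProb, Set.indicator_apply, Set.mem_ofPred_eq, p, Finset.prod_const,
      Finset.card_univ, Fintype.card_fin, ← Finset.sum_filter, Finset.sum_const, nsmul_eq_mul,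
      Fintype.card_pi, Finset.prod_const, Nat.cast_pow]
    rw [mul_assoc, ← mul_pow, one_div, inv_mul_cancel₀ hX.ne', one_pow, mul_one]
  rw [hcard]
  refine mul_le_mul_of_nonneg_right ?_ (Nat.cast_nonneg _)
  let g : Set U × X × Z → Fin n → X → ℝ := fun i t a =>
    if u t ∈ i.1 then
      W.prob i.2.1 (y t) i.2.2 * ((if a = i.2.1 then 1 else 0) - 1 / Fintype.card X) else 0
  refine (prodProb_mono hp ?_).trans
    (prodProb_iUnion_le_card_mul hp
      (fun i => {x | δ * n < |∑ t, g i t (x t)|}) fun i =>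
        prodProb_abs_sum_gt_le hp ?_ ?_ hδ0 hδ)
  · intro x hx
    simp only [Set.mem_ofPred_eq, Regular, not_forall, not_le] at hx
    obtain ⟨S, a, e, hx⟩ := hx
    exact Set.mem_iUnion.2 ⟨(S, a, e), hx⟩
  · intro t a
    have h0 := (W.prob_mem i.2.1 (y t)).1 i.2.2
    have h1 := W.prob_le_one i.2.1 (y t) i.2.2
    have h2 : 0 < 1 / (Fintype.card X : ℝ) := by positivity
    have h3 : 1 / (Fintype.card X : ℝ) ≤ 1 := by rw [div_le_one hX]; exact hX1
    simp only [g]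
    split_ifs
    · rw [abs_mul, abs_of_nonneg h0]
      exact mul_le_one₀ h1 (abs_nonneg _) (abs_le.2 ⟨by linarith, by linarith⟩)
    · rw [abs_mul, abs_of_nonneg h0]
      exact mul_le_one₀ h1 (abs_nonneg _) (abs_le.2 ⟨by linarith, by linarith⟩)
    · simp
  · intro t
    by_cases hc : u t ∈ i.1
    · simp only [g, p, if_pos hc, ← Finset.mul_sum, Finset.sum_sub_distrib]
      simp [hX.ne']
    · simp [g, if_neg hc]

end MAC

/-! ### Codebooks, decoder and error analysis. -/

namespace MAC

variable {X Y Z : Type*} [Fintype X] [Fintype Y] [Fintype Z] {N₁ N₂ n : ℕ}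

/-- A codeword of user 1 together with two codewords of user 2. -/
def sideInfo (x : Fin n → X) (y y' : Fin n → Y) : Fin n → X × Y × Y :=
  fun t => (x t, y t, y' t)

/-- The messages of user 1 which, for some input of user 2, are consistent with the output `z`
relative to all other codewords. -/
def candidates (W : MAC X Y Z) (δ : ℝ) (f₁ : Fin N₁ → Fin n → X) (f₂ : Fin N₂ → Fin n → Y)
    (z : Fin n → Z) : Set (Fin N₁) :=
  {m | ∃ y, ∀ m', m' ≠ m → ∀ j j',
    W.Consistent δ (f₁ m) y (sideInfo (f₁ m') (f₂ j) (f₂ j')) z}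

/-- The inputs `x` and `y` are not regular relative to `x'` and some codewords of user 2. -/
def IsBadPair (W : MAC X Y Z) (δ : ℝ) (f₂ : Fin N₂ → Fin n → Y) (y : Fin n → Y)
    (x x' : Fin n → X) : Prop :=
  ∃ j j', ¬ W.Regular δ x y (sideInfo x' (f₂ j) (f₂ j'))

open Classical in
/-- The messages of user 1 whose codewords are not regular relative to all other codewords when
user 2 sends `y`. -/
noncomputable def badMessages (W : MAC X Y Z) (δ : ℝ) (f₁ : Fin N₁ → Fin n → X)
    (f₂ : Fin N₂ → Fin n → Y) (y : Fin n → Y) : Finset (Fin N₁) :=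
  {m | ∃ m', m' ≠ m ∧ W.IsBadPair δ f₂ y (f₁ m) (f₁ m')}

/-- The bound on the probability of a deviation of `δ n`. -/
noncomputable def tailBound (_W : MAC X Y Z) (δ : ℝ) (n : ℕ) : ℝ :=
  Fintype.card (Set (X × Y × Y) × X × Z) * (2 * Real.exp (-(n * δ ^ 2 / 4)))

theorem tailBound_nonneg (W : MAC X Y Z) (δ : ℝ) (n : ℕ) : 0 ≤ W.tailBound δ n := by
  unfold tailBound; positivity

open Classical in
theorem card_isBadPair_le [Nonempty X] (W : MAC X Y Z) {δ : ℝ} (hδ0 : 0 ≤ δ) (hδ : δ ≤ 2)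
    (f₂ : Fin N₂ → Fin n → Y) (y : Fin n → Y) (x' : Fin n → X) :
    (Finset.card {x | W.IsBadPair δ f₂ y x x'} : ℝ) ≤
      N₂ * (N₂ * W.tailBound δ n) * Fintype.card (Fin n → X) := by
  have hsub : ({x | W.IsBadPair δ f₂ y x x'} : Finset (Fin n → X)) ⊆
      Finset.univ.biUnion fun p : Fin N₂ × Fin N₂ =>
        {x | ¬ W.Regular δ x y (sideInfo x' (f₂ p.1) (f₂ p.2))} := by
    intro x hx
    obtain ⟨j, j', h⟩ := (Finset.mem_filter.1 hx).2
    exact Finset.mem_biUnion.2 ⟨(j, j'), Finset.mem_univ _,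
      Finset.mem_filter.2 ⟨Finset.mem_univ _, h⟩⟩
  calc (Finset.card {x | W.IsBadPair δ f₂ y x x'} : ℝ)
      ≤ ∑ p : Fin N₂ × Fin N₂, (Finset.card {x | ¬ W.Regular δ x y
          (sideInfo x' (f₂ p.1) (f₂ p.2))} : ℝ) := by
        rw [← Nat.cast_sum, Nat.cast_le]
        exact (Finset.card_le_card hsub).trans Finset.card_biUnion_le
    _ ≤ ∑ _p : Fin N₂ × Fin N₂, W.tailBound δ n * (Fintype.card (Fin n → X) : ℝ) :=
        Finset.sum_le_sum fun p _ => W.card_not_regular_le hδ0 hδ y _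
    _ = _ := by
        rw [Finset.sum_const, Finset.card_univ, Fintype.card_prod, Fintype.card_fin, nsmul_eq_mul]
        push_cast
        ring

-- The attack `y` may depend on the codebook, hence a union over all `|Y| ^ n` sequences; the
-- exponent `k` is there to absorb that factor.
open Classical in
theorem card_many_badMessages_le [Nonempty X] (W : MAC X Y Z) {δ : ℝ} (hδ0 : 0 ≤ δ) (hδ : δ ≤ 2)
    (f₂ : Fin N₂ → Fin n → Y) (k : ℕ) :
    (Finset.card {f₁ : Fin N₁ → Fin n → X | ∃ y, 2 * k ≤ (W.badMessages δ f₁ f₂ y).card} : ℝ) ≤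
      (Fintype.card Y : ℝ) ^ n * (2 * (N₁ * (N₁ * (N₂ * (N₂ * W.tailBound δ n)))) ^ k) *
        Fintype.card (Fin N₁ → Fin n → X) := by
  have hsub : ({f₁ | ∃ y, 2 * k ≤ (W.badMessages δ f₁ f₂ y).card} :
      Finset (Fin N₁ → Fin n → X)) ⊆
      Finset.univ.biUnion fun y => {f₁ | 2 * k ≤ (W.badMessages δ f₁ f₂ y).card} := by
    intro f₁ hf
    obtain ⟨y, hy⟩ := (Finset.mem_filter.1 hf).2
    exact Finset.mem_biUnion.2 ⟨y, Finset.mem_univ _, Finset.mem_filter.2 ⟨Finset.mem_univ _, hy⟩⟩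
  have hT := W.tailBound_nonneg δ n
  calc (Finset.card {f₁ : Fin N₁ → Fin n → X | ∃ y, 2 * k ≤ (W.badMessages δ f₁ f₂ y).card} : ℝ)
      ≤ ∑ y : Fin n → Y, (Finset.card {f₁ : Fin N₁ → Fin n → X |
          2 * k ≤ (W.badMessages δ f₁ f₂ y).card} : ℝ) := by
        rw [← Nat.cast_sum, Nat.cast_le]
        exact (Finset.card_le_card hsub).trans Finset.card_biUnion_le
    _ ≤ ∑ _y : Fin n → Y, 2 * ((Fintype.card (Fin N₁) * (Fintype.card (Fin N₁) *
          (N₂ * (N₂ * W.tailBound δ n)))) ^ k * (Fintype.card (Fin N₁ → Fin n → X) : ℝ)) := by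
        refine Finset.sum_le_sum fun y _ => ?_
        refine le_of_eq_of_le ?_ (card_le_card_bad_le (ι := Fin N₁) (by positivity)
          (W.card_isBadPair_le hδ0 hδ f₂ y) k)
        unfold badMessages
        congr!
    _ = _ := by
        rw [Finset.sum_const, Finset.card_univ, Fintype.card_pi_const, Fintype.card_fin,
          nsmul_eq_mul]
        push_cast
        ring

-- Each requirement fails for less than half of all codebook pairs, counted with the other user's
-- codebook held fixed, so some pair meets both.
open Classical in
theorem exists_codebooks [Nonempty X] [Nonempty Y] (W : MAC X Y Z) {δ : ℝ} (hδ0 : 0 ≤ δ)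
    (hδ : δ ≤ 2) (k : ℕ)
    (h₁ : (Fintype.card Y : ℝ) ^ n *
      (2 * (N₁ * (N₁ * (N₂ * (N₂ * W.tailBound δ n)))) ^ k) < 1 / 2)
    (h₂ : (Fintype.card X : ℝ) ^ n *
      (2 * (N₂ * (N₂ * (N₁ * (N₁ * W.swap.tailBound δ n)))) ^ k) < 1 / 2) :
    ∃ (f₁ : Fin N₁ → Fin n → X) (f₂ : Fin N₂ → Fin n → Y),
      (∀ y, (W.badMessages δ f₁ f₂ y).card < 2 * k) ∧
      ∀ x, (W.swap.badMessages δ f₂ f₁ x).card < 2 * k := by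
  by_contra! hcon
  have hF : (0 : ℝ) < Fintype.card (Fin N₁ → Fin n → X) := by exact_mod_cast Fintype.card_pos
  have hG : (0 : ℝ) < Fintype.card (Fin N₂ → Fin n → Y) := by exact_mod_cast Fintype.card_pos
  have key : ∀ (f₁ : Fin N₁ → Fin n → X) (f₂ : Fin N₂ → Fin n → Y), (1 : ℝ) ≤
      (if ∃ y, 2 * k ≤ (W.badMessages δ f₁ f₂ y).card then 1 else 0) +
      (if ∃ x, 2 * k ≤ (W.swap.badMessages δ f₂ f₁ x).card then 1 else 0) := by
    intro f₁ f₂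
    by_cases h : ∃ y, 2 * k ≤ (W.badMessages δ f₁ f₂ y).card
    · rw [if_pos h]
      exact le_add_of_nonneg_right (by split_ifs <;> norm_num)
    · rw [if_pos (hcon f₁ f₂ (by simpa using h))]
      exact le_add_of_nonneg_left (by positivity)
  have hsum := Finset.sum_le_sum fun (f₁ : Fin N₁ → Fin n → X) (_ : f₁ ∈ Finset.univ) =>
    Finset.sum_le_sum fun (f₂ : Fin N₂ → Fin n → Y) (_ : f₂ ∈ Finset.univ) => key f₁ f₂
  simp only [Finset.sum_add_distrib] at hsum
  rw [Finset.sum_comm (f := fun (f₁ : Fin N₁ → Fin n → X) (f₂ : Fin N₂ → Fin n → Y) =>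
    if ∃ y, 2 * k ≤ (W.badMessages δ f₁ f₂ y).card then (1 : ℝ) else 0)] at hsum
  simp only [Finset.sum_boole, Finset.sum_const, Finset.card_univ, nsmul_eq_mul, mul_one] at hsum
  have b₁ : ∀ f₂ : Fin N₂ → Fin n → Y, (Finset.card {f₁ : Fin N₁ → Fin n → X |
      ∃ y, 2 * k ≤ (W.badMessages δ f₁ f₂ y).card} : ℝ) ≤
      1 / 2 * Fintype.card (Fin N₁ → Fin n → X) := fun f₂ =>
    (W.card_many_badMessages_le hδ0 hδ f₂ k).trans (mul_le_mul_of_nonneg_right h₁.le hF.le)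
  have b₂ : ∀ f₁ : Fin N₁ → Fin n → X, (Finset.card {f₂ : Fin N₂ → Fin n → Y |
      ∃ x, 2 * k ≤ (W.swap.badMessages δ f₂ f₁ x).card} : ℝ) <
      1 / 2 * Fintype.card (Fin N₂ → Fin n → Y) := fun f₁ =>
    (W.swap.card_many_badMessages_le hδ0 hδ f₁ k).trans_lt (mul_lt_mul_of_pos_right h₂ hG)
  have s₁ := Finset.sum_le_sum fun (f₂ : Fin N₂ → Fin n → Y) (_ : f₂ ∈ Finset.univ) => b₁ f₂
  have s₂ := Finset.sum_lt_sum_of_nonempty (Finset.univ_nonempty (α := Fin N₁ → Fin n → X))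
    fun f₁ _ => b₂ f₁
  simp only [Finset.sum_const, Finset.card_univ, nsmul_eq_mul] at s₁ s₂
  nlinarith

/-- The transmitted message is a candidate with high probability. -/
theorem sum_probPow_not_mem_candidates_le (W : MAC X Y Z) {δ : ℝ} (hδ0 : 0 ≤ δ) (hδ : δ ≤ 2)
    (f₁ : Fin N₁ → Fin n → X) (f₂ : Fin N₂ → Fin n → Y) (y : Fin n → Y) :
    ∑ m, W.probPow (f₁ m) y {z | m ∉ W.candidates (2 * δ) f₁ f₂ z} ≤
      (W.badMessages δ f₁ f₂ y).card + N₁ * (N₁ * (N₂ * (N₂ * W.tailBound δ n))) := by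
  classical
  have hT := W.tailBound_nonneg δ n
  have hm : ∀ m, W.probPow (f₁ m) y {z | m ∉ W.candidates (2 * δ) f₁ f₂ z} ≤
      (if m ∈ W.badMessages δ f₁ f₂ y then 1 else 0) +
        N₁ * (N₂ * (N₂ * W.tailBound δ n)) := by
    intro m
    rw [probPow_eq_prodProb]
    by_cases hb : m ∈ W.badMessages δ f₁ f₂ y
    · rw [if_pos hb]
      exact (prodProb_le_one (fun t => W.prob_mem _ _) _).trans
        (le_add_of_nonneg_right (by positivity))
    · rw [if_neg hb, zero_add]
      have hreg : ∀ m', m' ≠ m → ∀ j j',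
          W.Regular δ (f₁ m) y (sideInfo (f₁ m') (f₂ j) (f₂ j')) := by
        intro m' hne j j'
        by_contra hr
        exact hb (Finset.mem_filter.2 ⟨Finset.mem_univ _, m', hne, j, j', hr⟩)
      refine (prodProb_mono (fun t => W.prob_mem _ _) ?_).trans
        ((prodProb_iUnion_le_card_mul (ι := Fin N₁ × Fin N₂ × Fin N₂)
          (b := W.tailBound δ n) (fun t => W.prob_mem _ _)
          (fun i => {z | i.1 ≠ m ∧ ¬ W.Consistent (2 * δ) (f₁ m) y
            (sideInfo (f₁ i.1) (f₂ i.2.1) (f₂ i.2.2)) z}) fun i => ?_).trans (le_of_eq ?_))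
      · intro z hz
        simp only [candidates, Set.mem_ofPred_eq, not_exists, not_forall] at hz
        obtain ⟨m', hne, j, j', h⟩ := hz y
        exact Set.mem_iUnion.2 ⟨(m', j, j'), hne, h⟩
      · by_cases hne : i.1 = m
        · simp [hne, prodProb, hT]
        · exact (prodProb_mono (fun t => W.prob_mem _ _) fun z hz => hz.2).trans
            (W.probPow_not_consistent_le hδ0 hδ (hreg i.1 hne i.2.1 i.2.2))
      · simp [mul_assoc]
  refine (Finset.sum_le_sum fun m _ => hm m).trans (le_of_eq ?_)
  rw [Finset.sum_add_distrib]
  simp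

open Classical in
/-- The code that outputs a pair of candidates, or accuses a user without candidates. -/
noncomputable def candidateCode (W : MAC X Y Z) (δ : ℝ) (f₁ : Fin N₁ → Fin n → X)
    (f₂ : Fin N₂ → Fin n → Y) : AdvIdCode X Y Z N₁ N₂ n where
  enc₁ := f₁
  enc₂ := f₂
  dec z :=
    if h₁ : (W.candidates δ f₁ f₂ z).Nonempty then
      if h₂ : (W.swap.candidates δ f₂ f₁ z).Nonempty then .messages h₁.some h₂.some
      else .blameTwo
    else .blameOne

/-- User 1 has at most one candidate if user 2 has any. -/
theorem exists_candidates_unique [Nonempty X] [Nonempty Y] {W : MAC X Y Z}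
    (hW : ¬ W.IsOneSpoofable) : ∃ δ₀ > 0, ∀ δ ≤ δ₀, ∀ (N₁ N₂ n : ℕ), 0 < n → 2 ≤ N₂ →
      ∀ (f₁ : Fin N₁ → Fin n → X) (f₂ : Fin N₂ → Fin n → Y) (z : Fin n → Z),
        (W.swap.candidates δ f₂ f₁ z).Nonempty → (W.candidates δ f₁ f₂ z).Subsingleton := by
  obtain ⟨δ₀, hδ₀, h⟩ := exists_not_consistent hW
  refine ⟨δ₀, hδ₀, fun δ hδ N₁ N₂ n hn hN₂ f₁ f₂ z ⟨k, x₁, hk⟩ m ⟨y₁, hm⟩ m' ⟨y₂, hm'⟩ => ?_⟩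
  by_contra hne
  -- A candidate `k` is tested only against side information containing another codeword of user 2,
  -- so one must exist; which one is irrelevant.
  have : Nontrivial (Fin N₂) := Fin.nontrivial_iff_two_le.2 hN₂
  obtain ⟨k', hk'⟩ := exists_ne k
  exact h n hn (f₁ m) (f₁ m') x₁ (f₂ k) y₁ y₂ z (f₂ k')
    ((hm m' (Ne.symm hne) k k).mono hδ) ((hm' m hne k k).mono hδ) ((hk k' hk' m m').mono hδ)

/-- If an honest user's message is a candidate, that user is not accused, and uniqueness makes any
decoded pair contain that message. Every error thus forces an honest message out of the candidates.
-/
theorem errorProb_candidateCode_le [Nonempty X] [Nonempty Y] {W : MAC X Y Z} {δ : ℝ}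
    {f₁ : Fin N₁ → Fin n → X} {f₂ : Fin N₂ → Fin n → Y} (hN₁ : 0 < N₁) (hN₂ : 0 < N₂)
    (hu₁ : ∀ z, (W.swap.candidates δ f₂ f₁ z).Nonempty → (W.candidates δ f₁ f₂ z).Subsingleton)
    (hu₂ : ∀ z, (W.candidates δ f₁ f₂ z).Nonempty → (W.swap.candidates δ f₂ f₁ z).Subsingleton)
    {ε₁ ε₂ : ℝ} (hε₁ : 0 ≤ ε₁) (hε₂ : 0 ≤ ε₂)
    (h₁ : ∀ y, ∑ m, W.probPow (f₁ m) y {z | m ∉ W.candidates δ f₁ f₂ z} ≤ N₁ * ε₁)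
    (h₂ : ∀ x, ∑ m, W.swap.probPow (f₂ m) x {z | m ∉ W.swap.candidates δ f₂ f₁ z} ≤ N₂ * ε₂) :
    (W.candidateCode δ f₁ f₂).errorProb W ≤ ε₁ + ε₂ := by
  have hN₁' : (0 : ℝ) < N₁ := by exact_mod_cast hN₁
  have hN₂' : (0 : ℝ) < N₂ := by exact_mod_cast hN₂
  have mono : ∀ (x : Fin n → X) (y : Fin n → Y) {E F : Set (Fin n → Z)}, E ⊆ F →
      W.probPow x y E ≤ W.probPow x y F := fun x y E F h =>
    prodProb_mono (fun t => W.prob_mem _ _) h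
  have sub₁ : ∀ m, (W.candidateCode δ f₁ f₂).errorEvent₁ m ⊆
      {z | m ∉ W.candidates δ f₁ f₂ z} := by
    rintro m z ⟨hz1, hz2⟩ hm
    have hne : (W.candidates δ f₁ f₂ z).Nonempty := ⟨m, hm⟩
    by_cases h : (W.swap.candidates δ f₂ f₁ z).Nonempty
    · have heq := hu₁ z h hne.some_mem hm
      refine hz2 h.some ?_
      simp only [candidateCode, dif_pos hne, dif_pos h, heq]
    · exact hz1 (by simp only [candidateCode, dif_pos hne, dif_neg h])
  have sub₂ : ∀ m, (W.candidateCode δ f₁ f₂).errorEvent₂ m ⊆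
      {z | m ∉ W.swap.candidates δ f₂ f₁ z} := by
    rintro m z ⟨hz1, hz2⟩ hm
    have hne : (W.swap.candidates δ f₂ f₁ z).Nonempty := ⟨m, hm⟩
    by_cases h : (W.candidates δ f₁ f₂ z).Nonempty
    · have heq := hu₂ z h hne.some_mem hm
      refine hz2 h.some ?_
      simp only [candidateCode, dif_pos hne, dif_pos h, heq]
    · exact hz1 (by simp only [candidateCode, dif_neg h])
  have sub₀ : ∀ m₁ m₂, (W.candidateCode δ f₁ f₂).errorEvent m₁ m₂ ⊆
      {z | m₁ ∉ W.candidates δ f₁ f₂ z} ∪ {z | m₂ ∉ W.swap.candidates δ f₂ f₁ z} := by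
    intro m₁ m₂ z hz
    by_contra hcon
    simp only [Set.mem_union, Set.mem_ofPred_eq, not_or, not_not] at hcon
    have hne₁ : (W.candidates δ f₁ f₂ z).Nonempty := ⟨m₁, hcon.1⟩
    have hne₂ : (W.swap.candidates δ f₂ f₁ z).Nonempty := ⟨m₂, hcon.2⟩
    have e₁ := hu₁ z hne₂ hne₁.some_mem hcon.1
    have e₂ := hu₂ z hne₁ hne₂.some_mem hcon.2
    refine hz ?_
    simp only [candidateCode, dif_pos hne₁, dif_pos hne₂, e₁, e₂]
  refine max_le ?_ (max_le (ciSup_le fun x => ?_) (ciSup_le fun y => ?_))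
  · have hle : ∀ m₁ m₂, W.probPow (f₁ m₁) (f₂ m₂)
        ((W.candidateCode δ f₁ f₂).errorEvent m₁ m₂) ≤
        W.probPow (f₁ m₁) (f₂ m₂) {z | m₁ ∉ W.candidates δ f₁ f₂ z} +
        W.swap.probPow (f₂ m₂) (f₁ m₁) {z | m₂ ∉ W.swap.candidates δ f₂ f₁ z} := fun m₁ m₂ =>
      (mono _ _ (sub₀ m₁ m₂)).trans (prodProb_union_le (fun t => W.prob_mem _ _) _ _)
    have hs := Finset.sum_le_sum fun (m₁ : Fin N₁) (_ : m₁ ∈ Finset.univ) =>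
      Finset.sum_le_sum fun (m₂ : Fin N₂) (_ : m₂ ∈ Finset.univ) => hle m₁ m₂
    simp only [Finset.sum_add_distrib] at hs
    have t₁ : ∑ m₁, ∑ m₂, W.probPow (f₁ m₁) (f₂ m₂) {z | m₁ ∉ W.candidates δ f₁ f₂ z} ≤
        N₂ * (N₁ * ε₁) := by
      rw [Finset.sum_comm]
      refine (Finset.sum_le_sum fun m₂ _ => h₁ (f₂ m₂)).trans (le_of_eq ?_)
      simp
    have t₂ : ∑ m₁, ∑ m₂, W.swap.probPow (f₂ m₂) (f₁ m₁)
        {z | m₂ ∉ W.swap.candidates δ f₂ f₁ z} ≤ N₁ * (N₂ * ε₂) := by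
      refine (Finset.sum_le_sum fun m₁ _ => h₂ (f₁ m₁)).trans (le_of_eq ?_)
      simp
    rw [AdvIdCode.errorHonest, one_div, inv_mul_le_iff₀ (by positivity)]
    refine hs.trans ((add_le_add t₁ t₂).trans (le_of_eq ?_))
    ring
  · rw [one_div, inv_mul_le_iff₀ hN₂']
    refine (Finset.sum_le_sum fun m _ => mono x (f₂ m) (sub₂ m)).trans ((h₂ x).trans ?_)
    exact mul_le_mul_of_nonneg_left (le_add_of_nonneg_left hε₁) hN₂'.le
  · rw [one_div, inv_mul_le_iff₀ hN₁']
    refine (Finset.sum_le_sum fun m _ => mono (f₁ m) y (sub₁ m)).trans ((h₁ y).trans ?_)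
    exact mul_le_mul_of_nonneg_left (le_add_of_nonneg_right hε₂) hN₁'.le

end MAC

/-! ### Rates and asymptotics. -/

theorem tendsto_floor_two_rpow_mul {R : ℝ} (hR : 0 < R) :
    Tendsto (fun n : ℕ => ⌊(2 : ℝ) ^ ((n : ℝ) * R)⌋₊) atTop atTop := by
  refine tendsto_nat_floor_atTop.comp ?_
  have h : ∀ n : ℕ, (2 : ℝ) ^ ((n : ℝ) * R) = ((2 : ℝ) ^ R) ^ n := fun n => by
    rw [mul_comm, Real.rpow_mul (by norm_num), Real.rpow_natCast]
  simp only [h]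
  exact tendsto_pow_atTop_atTop_of_one_lt (Real.one_lt_rpow (by norm_num) hR)

theorem floor_two_rpow_mul_le {R c : ℝ} (hR : R * Real.log 2 ≤ c) (n : ℕ) :
    (⌊(2 : ℝ) ^ ((n : ℝ) * R)⌋₊ : ℝ) ≤ Real.exp (n * c) := by
  refine (Nat.floor_le (by positivity)).trans ?_
  rw [Real.rpow_def_of_pos (by norm_num)]
  refine Real.exp_le_exp.2 ?_
  have := mul_le_mul_of_nonneg_left hR (Nat.cast_nonneg (α := ℝ) n)
  linarith

namespace MAC

variable {X Y Z : Type*} [Fintype Z] {N₁ N₂ n : ℕ}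

theorem errorProb_nonneg (W : MAC X Y Z) (c : AdvIdCode X Y Z N₁ N₂ n) : 0 ≤ c.errorProb W :=
  le_max_of_le_left (mul_nonneg (by positivity) (Finset.sum_nonneg fun _ _ =>
    Finset.sum_nonneg fun _ _ => prodProb_nonneg (fun _ => W.prob_mem _ _) _))

/-- Users with a single message never cause an error. -/
theorem isAchievable_zero [Nonempty X] [Nonempty Y] (W : MAC X Y Z) :
    W.IsAchievable (0, 0) := by
  refine ⟨le_rfl, le_rfl, ?_⟩
  have hN : ∀ n : ℕ, ⌊(2 : ℝ) ^ ((n : ℝ) * (0 : ℝ))⌋₊ = 1 := fun n => by simp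
  have hex : ∀ n N₁ N₂ : ℕ, N₁ = 1 → N₂ = 1 →
      ∃ c : AdvIdCode X Y Z N₁ N₂ n, c.errorProb W = 0 := by
    rintro n _ _ rfl rfl
    refine ⟨⟨fun _ _ => Classical.arbitrary X, fun _ _ => Classical.arbitrary Y,
      fun _ => .messages 0 0⟩, ?_⟩
    simp [AdvIdCode.errorProb, AdvIdCode.errorHonest, AdvIdCode.errorAdvOne,
      AdvIdCode.errorAdvTwo, AdvIdCode.errorEvent, AdvIdCode.errorEvent₁, AdvIdCode.errorEvent₂,
      probPow]
  choose c hc using fun n => hex n _ _ (hN n) (hN n)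
  exact ⟨c, by simp [hc]⟩

theorem isAchievable_swap {W : MAC X Y Z} {R : ℝ × ℝ} (h : W.IsAchievable R) :
    W.swap.IsAchievable R.swap := by
  obtain ⟨h1, h2, c, hc⟩ := h
  exact ⟨h2, h1, fun n => (c n).swap, by simpa only [AdvIdCode.errorProb_swap] using hc⟩

variable [Fintype X] [Fintype Y]

/-- The four codebook factors cost `4 * (δ ^ 2 / 32)` out of the exponent `δ ^ 2 / 4`, leaving `δ ^
2 / 8`. -/
theorem mul_tailBound_le (W : MAC X Y Z) {δ : ℝ} (h₁ : (N₁ : ℝ) ≤ Real.exp (n * (δ ^ 2 / 32)))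
    (h₂ : (N₂ : ℝ) ≤ Real.exp (n * (δ ^ 2 / 32))) :
    N₁ * (N₁ * (N₂ * (N₂ * W.tailBound δ n))) ≤
      2 * Fintype.card (Set (X × Y × Y) × X × Z) * Real.exp (-(n * (δ ^ 2 / 8))) := by
  have hT := W.tailBound_nonneg δ n
  set E := Real.exp (n * (δ ^ 2 / 32)) with hE
  calc N₁ * (N₁ * (N₂ * (N₂ * W.tailBound δ n)))
      ≤ E * (E * (E * (E * W.tailBound δ n))) := by gcongr
    _ = 2 * Fintype.card (Set (X × Y × Y) × X × Z) *
          (E * E * E * E * Real.exp (-(n * δ ^ 2 / 4))) := by rw [tailBound]; ring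
    _ = _ := by
        rw [hE, ← Real.exp_add, ← Real.exp_add, ← Real.exp_add, ← Real.exp_add]
        congr 2
        ring

theorem pow_card_mul_le {A : Type*} [Fintype A] [Nonempty A] {C c : ℝ} (hC : 0 ≤ C) {k : ℕ}
    (hk : Real.log (Fintype.card A) + 1 ≤ k * c) {P : ℝ} (hP0 : 0 ≤ P)
    (hP : P ≤ C * Real.exp (-(n * c))) :
    (Fintype.card A : ℝ) ^ n * (2 * P ^ k) ≤ 2 * C ^ k * Real.exp (-n) := by
  have hA : (0 : ℝ) < Fintype.card A := by exact_mod_cast Fintype.card_pos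
  have h1 : (Fintype.card A : ℝ) ^ n = Real.exp (n * Real.log (Fintype.card A)) := by
    rw [Real.exp_nat_mul, Real.exp_log hA]
  calc (Fintype.card A : ℝ) ^ n * (2 * P ^ k)
      ≤ (Fintype.card A : ℝ) ^ n * (2 * (C * Real.exp (-(n * c))) ^ k) := by gcongr
    _ = 2 * C ^ k * Real.exp (n * Real.log (Fintype.card A) + k * (-(n * c))) := by
        rw [h1, mul_pow, ← Real.exp_nat_mul, Real.exp_add]; ring
    _ ≤ 2 * C ^ k * Real.exp (-n) := by
        gcongr
        have := mul_le_mul_of_nonneg_left hk (Nat.cast_nonneg (α := ℝ) n)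
        linarith

theorem exists_isAchievable [Nonempty X] [Nonempty Y] {W : MAC X Y Z} (h₁ : ¬ W.IsOneSpoofable)
    (h₂ : ¬ W.IsTwoSpoofable) :
    ∃ R₀ > 0, ∀ R₁ R₂ : ℝ, 0 < R₁ → R₁ < R₀ → 0 < R₂ → R₂ < R₀ → W.IsAchievable (R₁, R₂) := by
  obtain ⟨δ₁, hδ₁, hu₁⟩ := exists_candidates_unique h₁
  obtain ⟨δ₂, hδ₂, hu₂⟩ := exists_candidates_unique (mt isTwoSpoofable_of_swap h₂)
  obtain ⟨δ, hδ0, hδ2, hδ₁', hδ₂'⟩ : ∃ δ : ℝ, 0 < δ ∧ δ ≤ 2 ∧ 2 * δ ≤ δ₁ ∧ 2 * δ ≤ δ₂ := by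
    refine ⟨min 2 (min (δ₁ / 2) (δ₂ / 2)), by positivity, min_le_left _ _, ?_, ?_⟩
    · linarith [min_le_right 2 (min (δ₁ / 2) (δ₂ / 2)), min_le_left (δ₁ / 2) (δ₂ / 2)]
    · linarith [min_le_right 2 (min (δ₁ / 2) (δ₂ / 2)), min_le_right (δ₁ / 2) (δ₂ / 2)]
  have hlog : 0 < Real.log 2 := Real.log_pos (by norm_num)
  refine ⟨δ ^ 2 / 32 / Real.log 2, by positivity, fun R₁ R₂ hR₁ hR₁' hR₂ hR₂' => ?_⟩
  have hc : 0 < δ ^ 2 / 8 := by positivity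
  -- `k` does not depend on `n`, yet `k * (δ ^ 2 / 8)` exceeds the exponential growth rate of the
  -- number of attack sequences of either user.
  obtain ⟨k, hk⟩ := exists_nat_ge
    (max (Real.log (Fintype.card X) + 1) (Real.log (Fintype.card Y) + 1) / (δ ^ 2 / 8))
  rw [div_le_iff₀ hc, max_le_iff] at hk
  set C₁ : ℝ := 2 * (Fintype.card (Set (X × Y × Y) × X × Z) : ℝ) with hC₁
  set C₂ : ℝ := 2 * (Fintype.card (Set (Y × X × X) × Y × Z) : ℝ) with hC₂
  have hC₁0 : 0 ≤ C₁ := by positivity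
  have hC₂0 : 0 ≤ C₂ := by positivity
  set N₁ : ℕ → ℕ := fun n => ⌊(2 : ℝ) ^ ((n : ℝ) * R₁)⌋₊ with hN₁
  set N₂ : ℕ → ℕ := fun n => ⌊(2 : ℝ) ^ ((n : ℝ) * R₂)⌋₊ with hN₂
  have tN₁ : Tendsto N₁ atTop atTop := tendsto_floor_two_rpow_mul hR₁
  have tN₂ : Tendsto N₂ atTop atTop := tendsto_floor_two_rpow_mul hR₂
  have bN₁ : ∀ n : ℕ, (N₁ n : ℝ) ≤ Real.exp (n * (δ ^ 2 / 32)) :=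
    floor_two_rpow_mul_le ((lt_div_iff₀ hlog).1 hR₁').le
  have bN₂ : ∀ n : ℕ, (N₂ n : ℝ) ≤ Real.exp (n * (δ ^ 2 / 32)) :=
    floor_two_rpow_mul_le ((lt_div_iff₀ hlog).1 hR₂').le
  -- For each user, `2 * k` bounds the bad messages and `C₁` or `C₂` the total error of the others;
  -- both are constants divided by a growing number of messages.
  let ε : ℕ → ℝ := fun n => (2 * k + C₁) / N₁ n + (2 * k + C₂) / N₂ n
  have hε : Tendsto ε atTop (𝓝 0) := by
    have e₁ : Tendsto (fun n => (2 * k + C₁) / (N₁ n : ℝ)) atTop (𝓝 0) :=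
      tendsto_const_nhds.div_atTop (tendsto_natCast_atTop_atTop.comp tN₁)
    have e₂ : Tendsto (fun n => (2 * k + C₂) / (N₂ n : ℝ)) atTop (𝓝 0) :=
      tendsto_const_nhds.div_atTop (tendsto_natCast_atTop_atTop.comp tN₂)
    simpa using e₁.add e₂
  have hsmall : ∀ C : ℝ, ∀ᶠ n : ℕ in atTop, 2 * C ^ k * Real.exp (-(n : ℝ)) < 1 / 2 := fun C => by
    have : Tendsto (fun n : ℕ => 2 * C ^ k * Real.exp (-(n : ℝ))) atTop (𝓝 (2 * C ^ k * 0)) :=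
      (Real.tendsto_exp_neg_atTop_nhds_zero.comp tendsto_natCast_atTop_atTop).const_mul _
    rw [mul_zero] at this
    exact this.eventually_lt_const (by norm_num)
  have hcode : ∀ᶠ n in atTop, ∃ c : AdvIdCode X Y Z (N₁ n) (N₂ n) n, c.errorProb W ≤ ε n := by
    filter_upwards [eventually_gt_atTop 0, tN₁.eventually_ge_atTop 2, tN₂.eventually_ge_atTop 2,
      hsmall C₁, hsmall C₂] with n hn hn₁ hn₂ hs₁ hs₂
    have T₁ := W.mul_tailBound_le (bN₁ n) (bN₂ n)
    have T₂ := W.swap.mul_tailBound_le (bN₂ n) (bN₁ n)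
    have p₁ := W.tailBound_nonneg δ n
    have p₂ := W.swap.tailBound_nonneg δ n
    obtain ⟨f₁, f₂, hb₁, hb₂⟩ := W.exists_codebooks hδ0.le hδ2 k
      ((pow_card_mul_le hC₁0 hk.2 (by positivity) T₁).trans_lt hs₁)
      ((pow_card_mul_le hC₂0 hk.1 (by positivity) T₂).trans_lt hs₂)
    have hp₁ : (0 : ℝ) < N₁ n := by exact_mod_cast (by omega : 0 < N₁ n)
    have hp₂ : (0 : ℝ) < N₂ n := by exact_mod_cast (by omega : 0 < N₂ n)
    have hexp : Real.exp (-(n * (δ ^ 2 / 8))) ≤ 1 :=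
      Real.exp_le_one_iff.2 (neg_nonpos.2 (by positivity))
    refine ⟨W.candidateCode (2 * δ) f₁ f₂, errorProb_candidateCode_le (by omega) (by omega)
      (hu₁ _ hδ₁' _ _ n hn hn₂ f₁ f₂) (hu₂ _ hδ₂' _ _ n hn hn₁ f₂ f₁) (by positivity)
      (by positivity) (fun y => ?_) fun x => ?_⟩
    · rw [mul_div_cancel₀ _ hp₁.ne']
      refine (W.sum_probPow_not_mem_candidates_le hδ0.le hδ2 f₁ f₂ y).trans (add_le_add ?_ ?_)
      · exact_mod_cast (hb₁ y).le
      · exact T₁.trans (mul_le_of_le_one_right hC₁0 hexp)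
    · rw [mul_div_cancel₀ _ hp₂.ne']
      refine (W.swap.sum_probPow_not_mem_candidates_le hδ0.le hδ2 f₂ f₁ x).trans (add_le_add ?_ ?_)
      · exact_mod_cast (hb₂ x).le
      · exact T₂.trans (mul_le_of_le_one_right hC₂0 hexp)
  -- Achievability needs a code at every length; where the construction gives none, an arbitrary
  -- code is used.
  have hex : ∀ n, ∃ c : AdvIdCode X Y Z (N₁ n) (N₂ n) n,
      (∃ c' : AdvIdCode X Y Z (N₁ n) (N₂ n) n, c'.errorProb W ≤ ε n) → c.errorProb W ≤ ε n := by
    intro n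
    by_cases h : ∃ c' : AdvIdCode X Y Z (N₁ n) (N₂ n) n, c'.errorProb W ≤ ε n
    · exact h.imp fun c hc _ => hc
    · exact ⟨⟨fun _ _ => Classical.arbitrary X, fun _ _ => Classical.arbitrary Y,
        fun _ => .blameOne⟩, fun h' => absurd h' h⟩
  choose c hc using hex
  refine ⟨hR₁.le, hR₂.le, c, ?_⟩
  refine tendsto_of_tendsto_of_tendsto_of_le_of_le' tendsto_const_nhds hε
    (Eventually.of_forall fun n => W.errorProb_nonneg (c n)) ?_
  filter_upwards [hcode] with n hn using hc n hn

/-- At a positive rate user 1 eventually has two messages, which keeps the error at `1/5` or above.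
The non-strict bound is a closed condition and so passes to the capacity region. -/
theorem rate_eq_zero_of_isOneSpoofable {W : MAC X Y Z} (hW : W.IsOneSpoofable) {R : ℝ × ℝ}
    (hR : W.IsAchievable R) : R.1 ≤ 0 := by
  obtain ⟨-, h2, c, hc⟩ := hR
  by_contra! hpos
  obtain ⟨n, hn₁, hn⟩ := (((tendsto_floor_two_rpow_mul hpos).eventually_ge_atTop 2).and
    (hc.eventually_lt_const (show (0 : ℝ) < 1 / 5 by norm_num))).exists
  refine absurd ((c n).one_div_five_le_errorProb hW hn₁ ?_) (not_le.2 hn)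
  exact Nat.le_floor (by simpa using Real.one_le_rpow one_le_two (by positivity))

end MAC

theorem theorem1 {X Y Z : Type*} [Fintype X] [Nonempty X] [Fintype Y] [Nonempty Y] [Fintype Z]
    (W : MAC X Y Z) :
    -- 1-spoofable: user 1 cannot communicate (its capacity, a supremum, is zero)
    (W.IsOneSpoofable →
      (∀ (N₁ N₂ n : ℕ) (c : AdvIdCode X Y Z N₁ N₂ n), 2 ≤ N₁ → 1 ≤ N₂ →
        (1 / 12 : ℝ) ≤ c.errorProb W) ∧
      IsLUB {R₁ : ℝ | ∃ R₂ : ℝ, (R₁, R₂) ∈ W.capacityRegion} 0) ∧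
    -- 2-spoofable: user 2 cannot communicate
    (W.IsTwoSpoofable →
      (∀ (N₁ N₂ n : ℕ) (c : AdvIdCode X Y Z N₁ N₂ n), 1 ≤ N₁ → 2 ≤ N₂ →
        (1 / 12 : ℝ) ≤ c.errorProb W) ∧
      IsLUB {R₂ : ℝ | ∃ R₁ : ℝ, (R₁, R₂) ∈ W.capacityRegion} 0) ∧
    -- neither: both users can communicate at positive rates
    (¬ W.IsOneSpoofable → ¬ W.IsTwoSpoofable →
      (interior W.capacityRegion).Nonempty ∧
      ∃ R₁ R₂ : ℝ, 0 < R₁ ∧ 0 < R₂ ∧ W.IsAchievable (R₁, R₂)) := by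
  have hzero : ((0 : ℝ), (0 : ℝ)) ∈ W.capacityRegion := subset_closure W.isAchievable_zero
  refine ⟨fun h => ⟨fun N₁ N₂ n c hN₁ hN₂ => ?_, ?_, fun b hb => hb ⟨0, hzero⟩⟩,
    fun h => ⟨fun N₁ N₂ n c hN₁ hN₂ => ?_, ?_, fun b hb => hb ⟨0, hzero⟩⟩, fun h₁ h₂ => ?_⟩
  · exact le_trans (by norm_num) (c.one_div_five_le_errorProb h hN₁ hN₂)
  · rintro R₁ ⟨R₂, hR⟩
    exact closure_minimal (t := {R : ℝ × ℝ | R.1 ≤ 0})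
      (fun R hR => MAC.rate_eq_zero_of_isOneSpoofable h hR)
      (isClosed_le continuous_fst continuous_const) hR
  · rw [← c.errorProb_swap]
    exact le_trans (by norm_num)
      (c.swap.one_div_five_le_errorProb (MAC.isOneSpoofable_swap h) hN₂ hN₁)
  · rintro R₂ ⟨R₁, hR⟩
    exact closure_minimal (t := {R : ℝ × ℝ | R.2 ≤ 0})
      (fun R hR => MAC.rate_eq_zero_of_isOneSpoofable (MAC.isOneSpoofable_swap h)
        (MAC.isAchievable_swap hR))
      (isClosed_le continuous_snd continuous_const) hR
  · obtain ⟨R₀, hR₀, hach⟩ := MAC.exists_isAchievable h₁ h₂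
    have hhalf : R₀ / 2 < R₀ := half_lt_self hR₀
    refine ⟨⟨(R₀ / 2, R₀ / 2), ?_⟩, R₀ / 2, R₀ / 2, half_pos hR₀, half_pos hR₀,
      hach _ _ (half_pos hR₀) hhalf (half_pos hR₀) hhalf⟩
    refine interior_maximal (t := Set.Ioo 0 R₀ ×ˢ Set.Ioo 0 R₀) ?_ (isOpen_Ioo.prod isOpen_Ioo)
      ⟨⟨half_pos hR₀, hhalf⟩, half_pos hR₀, hhalf⟩
    rintro ⟨R₁, R₂⟩ ⟨hR₁, hR₂⟩
    exact subset_closure (hach R₁ R₂ hR₁.1 hR₁.2 hR₂.1 hR₂.2)
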